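/- Let $n\ge 1$ and let $s,s_1,s_2,\lambda_1,\lambda_2$ be real numbers with $$s=s_1+s_2\in(0,2),\qquad s_j\in(0,1),\qquad \lambda_j<1+\frac{2s_j}{n}\qquad(j=1,2).$$ Let $D^{\sigma}=(-\Delta)^{\sigma/2}$, i.e. the Fourier multiplier operator on $\mathbb{R}^n$ with symbol $|\xi|^{\sigma}$ (for the Fourier transform with phase $e^{-ix\cdot\xi}$). For a bounded continuous function $f$ on $\mathbb{R}^n$ let $$U_f(x,t)=\frac{\Gamma(\frac{n+1}{2})}{\pi^{\frac{n+1}{2}}}\int_{\mathbb{R}^n}\frac{t\,f(x-y)}{(t^2+|y|^2)^{\frac{n+1}{2}}}\,dy,\qquad x\in\mathbb{R}^n,\ t>0,$$ be its harmonic extension to the upper half space, and for $\lambda\in\mathbb{R}$ let $$g^*_{\lambda}(f)(x)=\Bigl[\int_0^\infty\int_{\mathbb{R}^n}\Bigl(\frac{t}{t+|y|}\Bigr)^{\lambda n}t^{1-n}\,|\partial_{t,x}U_f(x-y,t)|^2\,dy\,dt\Bigr]^{1/2}\in[0,\infty]$$ be the Littlewood nontangential square function, where $\partial_{t,x}=(\partial_t,\partial_{x_1},\dots,\partial_{x_n})$.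 Then there is a constant $C<\infty$, depending only on $n,s_1,s_2,\lambda_1,\lambda_2$, such that for all (complex-valued) Schwartz functions $u,v\in\mathscr{S}(\mathbb{R}^n)$ and all $x\in\mathbb{R}^n$, $$\bigl|D^s(uv)-u\,D^sv-v\,D^su\bigr|(x)\le C\,g^*_{\lambda_1}(D^{s_1}u)(x)\cdot g^*_{\lambda_2}(D^{s_2}v)(x),$$ where $0\cdot\infty=0$ on the right-hand side. -/

import Mathlib

open MeasureTheory Set
open scoped FourierTransform SchwartzMap ENNReal NNReal

noncomputable section

namespace FracCommutator

/-- The fractional derivative `D ^ s = (-Δ) ^ (s / 2)`, as the Fourier multiplier `|ξ| ^ s`.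
Mathlib's Fourier transform has the phase `exp (-2 π i ⟪x, ξ⟫)`, in which the symbol of `-Δ` is
`(2 π |ξ|) ^ 2`; hence the factor `2 π`. -/
def fracD {n : ℕ} (s : ℝ) (f : EuclideanSpace ℝ (Fin n) → ℂ) : EuclideanSpace ℝ (Fin n) → ℂ :=
  𝓕⁻ (fun ξ : EuclideanSpace ℝ (Fin n) => (((2 * Real.pi * ‖ξ‖) ^ s : ℝ) : ℂ) * 𝓕 f ξ)

/-- The Poisson kernel of the half space `ℝⁿ × (0, ∞)`. -/
def halfSpacePoissonKernel {n : ℕ} (y : EuclideanSpace ℝ (Fin n)) (t : ℝ) : ℝ :=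
  Real.Gamma (((n : ℝ) + 1) / 2) / Real.pi ^ (((n : ℝ) + 1) / 2) *
    (t / (t ^ 2 + ‖y‖ ^ 2) ^ (((n : ℝ) + 1) / 2))

/-- The harmonic extension `U (x, t)` of `f` to the half space, by its Poisson integral. -/
def harmonicExtension {n : ℕ} (f : EuclideanSpace ℝ (Fin n) → ℂ)
    (x : EuclideanSpace ℝ (Fin n)) (t : ℝ) : ℂ :=
  ∫ y : EuclideanSpace ℝ (Fin n), (halfSpacePoissonKernel y t : ℂ) * f (x - y)

/-- `|∂_{t,x} U (x, t)| ^ 2`, the squared length of the full gradient of the harmonic extension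
of `f`: the sum of the squared moduli of its `n + 1` first partial derivatives. -/
def gradSq {n : ℕ} (f : EuclideanSpace ℝ (Fin n) → ℂ)
    (x : EuclideanSpace ℝ (Fin n)) (t : ℝ) : ℝ :=
  ‖deriv (fun τ : ℝ => harmonicExtension f x τ) t‖ ^ 2 +
    ∑ i : Fin n,
      ‖lineDeriv ℝ (fun z => harmonicExtension f z t) x (EuclideanSpace.single i (1 : ℝ))‖ ^ 2

/-- The Littlewood nontangential square function `g*_lam (f) (x)`, with values in `[0, ∞]`. -/
def gStar {n : ℕ} (lam : ℝ) (f : EuclideanSpace ℝ (Fin n) → ℂ)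
    (x : EuclideanSpace ℝ (Fin n)) : ℝ≥0∞ :=
  (∫⁻ t in Ioi (0 : ℝ), ∫⁻ y : EuclideanSpace ℝ (Fin n),
    ENNReal.ofReal ((t / (t + ‖y‖)) ^ (lam * n) * t ^ (1 - (n : ℝ)) * gradSq f (x - y) t))
      ^ (1 / 2 : ℝ)

end FracCommutator

end

namespace FracCommutator

/-! ### Radial power integrals over balls and their complements. -/

section PowerIntegrals

/-! For `0 < s < 2`, `D ^ s f (x)` is a constant times the integral of `|h| ^ (-n - s)` against `2
f(x) - f(x + h) - f(x - h)`. In the commutator these second differences combine algebraically: what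
remains at `h` is `-(u(x + h) - u(x)) (v(x + h) - v(x))` plus the same expression at `-h`. So the
commutator is bounded by the integral of `|h| ^ (-n - s)` against products of first differences
(`exists_enorm_commutator_le`). As `s = s₁ + s₂`, Cauchy–Schwarz (`lintegral_rpow_mul_mul_le`)
leaves a bound for one function: the `L²` norm of `h ↦ u(x + h) - u(x)` with weight `|h| ^ (-n -
2σ)` is at most a constant times `g*_λ (D ^ σ u)(x)` when `λ n < n + 2σ`
(`exists_difference_le_gStar`).

For this bound, let `U` be the harmonic extension of `D ^ σ u` and `φ_t` the `L¹`-normalised dilates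
of a radial bump. By homogeneity and rotation invariance, the integral of `t ^ σ (φ_t * ∂_t U)(x)`
over `t > 0` is a nonzero constant times `u(x)` (`exists_integral_bumpAverage_eq`). A shift of `x`
can be moved onto the bump, so `u(x + h) - u(x)` is dominated by an integral of `|∂_t U(x - y, t)|`
against `t ^ (σ - n) |φ((y + h)/t) - φ(y/t)|` (`exists_enorm_sub_le`).

This kernel splits into three pieces: a Lipschitz piece for `|h| < t`, and the two separate bumps
for `t ≤ |h|`. Schur's test with powers of `t` as weights handles each (`schur_power_kernel`). The
first two live over the cone `|y| ≤ 2t`, where every weight of `g*` is comparable to `t ^ (1 - n)`.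
In the third, `y` is near `-h` and `t + |y|` is at most `3 |h|`; this piece produces the weight
exponent `n + 2σ - ε`. The loss `ε` makes an integral converge at `t = 0`, and the strict inequality
on `λ` pays for it. -/

lemma pow_finrank_sub_one_mul_rpow (E : Type*) [NormedAddCommGroup E] [NormedSpace ℝ E]
    [FiniteDimensional ℝ E] [Nontrivial E] {r : ℝ} (hr : 0 < r) (a : ℝ) :
    r ^ (Module.finrank ℝ E - 1) * r ^ a = r ^ (Module.finrank ℝ E - 1 + a : ℝ) := by
  rw [Real.rpow_add hr, ← Real.rpow_natCast, Nat.cast_sub Module.finrank_pos, Nat.cast_one]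

variable {E : Type*} [NormedAddCommGroup E] [NormedSpace ℝ E] [FiniteDimensional ℝ E]
  [MeasurableSpace E] [BorelSpace E] [Nontrivial E]

lemma lintegral_fun_norm (μ : Measure E) [μ.IsAddHaarMeasure] {f : ℝ → ℝ} (hf : ∀ r, 0 ≤ f r)
    (hint : IntegrableOn (fun r : ℝ => r ^ (Module.finrank ℝ E - 1) * f r) (Ioi 0)) :
    ∫⁻ x, ENNReal.ofReal (f ‖x‖) ∂μ = ENNReal.ofReal (Module.finrank ℝ E *
      (μ.real (Metric.ball 0 1) * ∫ r in Ioi (0 : ℝ), r ^ (Module.finrank ℝ E - 1) * f r)) := by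
  have h1 : Integrable (fun x : E => f ‖x‖) μ := (integrable_fun_norm_addHaar μ).2 hint
  rw [← ofReal_integral_eq_lintegral_ofReal h1 (ae_of_all _ fun _ => hf _),
    integral_fun_norm_addHaar]
  simp [smul_eq_mul]

lemma setLIntegral_Iio_rpow {p : ℝ} (hp : 0 < p) {t : ℝ} (ht : 0 < t) :
    ∫⁻ r in Ioc 0 t, ENNReal.ofReal (r ^ (p - 1)) = ENNReal.ofReal (t ^ p / p) := by
  have hi : IntervalIntegrable (fun r : ℝ => r ^ (p - 1)) volume 0 t :=
    intervalIntegral.intervalIntegrable_rpow' (by linarith)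
  rw [← ofReal_integral_eq_lintegral_ofReal
    ((intervalIntegrable_iff_integrableOn_Ioc_of_le ht.le).1 hi)
    ((ae_restrict_iff' measurableSet_Ioc).2 (ae_of_all _ fun r hr => Real.rpow_nonneg hr.1.le _)),
    ← intervalIntegral.integral_of_le ht.le, integral_rpow (Or.inl (by linarith))]
  simp [hp.ne']

lemma setLIntegral_Ioi_rpow {p : ℝ} (hp : 0 < p) {t : ℝ} (ht : 0 < t) :
    ∫⁻ r in Ioi t, ENNReal.ofReal (r ^ (-p - 1)) = ENNReal.ofReal (t ^ (-p) / p) := by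
  rw [← ofReal_integral_eq_lintegral_ofReal (integrableOn_Ioi_rpow_of_lt (by linarith) ht)
    ((ae_restrict_iff' measurableSet_Ioi).2 (ae_of_all _ fun r hr =>
      Real.rpow_nonneg (ht.trans hr).le _)),
    integral_Ioi_rpow_of_lt (by linarith) ht]
  congr 1
  rw [show -p - 1 + 1 = -p by ring, neg_div_neg_eq]

/-- The integral of `|h| ^ (-d - q)` outside the ball of radius `t` is `O (t ^ (-q))`. -/
lemma exists_lintegral_norm_ge_le (μ : Measure E) [μ.IsAddHaarMeasure] {q : ℝ} (hq : 0 < q) :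
    ∃ C : ℝ≥0, ∀ t : ℝ, 0 < t → ∫⁻ h in {h : E | t ≤ ‖h‖},
      ENNReal.ofReal (‖h‖ ^ (-Module.finrank ℝ E - q : ℝ)) ∂μ ≤ C * ENNReal.ofReal (t ^ (-q)) := by
  refine ⟨(Module.finrank ℝ E * (μ.real (Metric.ball 0 1) / q)).toNNReal, fun t ht => ?_⟩
  have hm : MeasurableSet {h : E | t ≤ ‖h‖} := measurableSet_le measurable_const measurable_norm
  set f : ℝ → ℝ := (Ici t).indicator fun r => r ^ (-Module.finrank ℝ E - q : ℝ) with hf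
  have heq : ∀ r ∈ Ioi (0 : ℝ), r ^ (Module.finrank ℝ E - 1) * f r =
      (Ici t).indicator (fun r => r ^ (-q - 1)) r := by
    intro r hr
    by_cases hrt : r ∈ Ici t
    · rw [hf, indicator_of_mem hrt, indicator_of_mem hrt, pow_finrank_sub_one_mul_rpow E hr]
      ring_nf
    · rw [hf, indicator_of_notMem hrt, indicator_of_notMem hrt, mul_zero]
  have hint : IntegrableOn (fun r => r ^ (Module.finrank ℝ E - 1) * f r) (Ioi 0) := by
    rw [integrableOn_congr_fun heq measurableSet_Ioi]
    refine (IntegrableOn.integrable_indicator ?_ measurableSet_Ici).integrableOn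
    exact (integrableOn_Ici_iff_integrableOn_Ioi (by simp)).2 (integrableOn_Ioi_rpow_of_lt (by linarith) ht)
  have h0 : ∀ r, 0 ≤ f r := fun r => indicator_nonneg
    (fun r hr => Real.rpow_nonneg (ht.le.trans hr) _) r
  have h1 : ∫⁻ h in {h : E | t ≤ ‖h‖}, ENNReal.ofReal (‖h‖ ^ (-Module.finrank ℝ E - q : ℝ)) ∂μ
      = ∫⁻ h : E, ENNReal.ofReal (f ‖h‖) ∂μ := by
    rw [← lintegral_indicator hm]
    refine lintegral_congr fun h => ?_
    by_cases hh : t ≤ ‖h‖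
    · rw [indicator_of_mem (by exact hh), hf, indicator_of_mem (by exact hh)]
    · rw [indicator_of_notMem (by exact hh), hf, indicator_of_notMem (by exact hh),
        ENNReal.ofReal_zero]
  rw [h1, lintegral_fun_norm μ h0 hint, setIntegral_congr_fun measurableSet_Ioi heq,
    setIntegral_indicator measurableSet_Ici, inter_eq_right.2 (Ici_subset_Ioi.2 ht),
    integral_Ici_eq_integral_Ioi, integral_Ioi_rpow_of_lt (by linarith) ht,
    ENNReal.ofNNReal_toNNReal, ← ENNReal.ofReal_mul (by positivity)]
  apply le_of_eq
  congr 1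
  rw [show -q - 1 + 1 = -q by ring, neg_div_neg_eq]
  ring

/-- The integral of `|h| ^ (q - d)` over the ball of radius `t` is `O (t ^ q)`. -/
lemma exists_lintegral_norm_lt_le (μ : Measure E) [μ.IsAddHaarMeasure] {q : ℝ} (hq : 0 < q) :
    ∃ C : ℝ≥0, ∀ t : ℝ, 0 < t → ∫⁻ h in {h : E | ‖h‖ < t},
      ENNReal.ofReal (‖h‖ ^ (q - Module.finrank ℝ E : ℝ)) ∂μ ≤ C * ENNReal.ofReal (t ^ q) := by
  refine ⟨(Module.finrank ℝ E * (μ.real (Metric.ball 0 1) / q)).toNNReal, fun t ht => ?_⟩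
  have hm : MeasurableSet {h : E | ‖h‖ < t} := measurableSet_lt measurable_norm measurable_const
  -- The radius `0` is included so that `f ‖h‖` agrees with the integrand at every point of the
  -- ball, the centre among them; the radial integral does not see it.
  set f : ℝ → ℝ := (Ico 0 t).indicator fun r => r ^ (q - Module.finrank ℝ E : ℝ) with hf
  have heq : ∀ r ∈ Ioi (0 : ℝ), r ^ (Module.finrank ℝ E - 1) * f r =
      (Ioo 0 t).indicator (fun r => r ^ (q - 1)) r := by
    intro r hr
    by_cases hrt : r < t
    · rw [hf, indicator_of_mem (show r ∈ Ico 0 t from ⟨le_of_lt hr, hrt⟩),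
        indicator_of_mem (show r ∈ Ioo 0 t from ⟨hr, hrt⟩),
        pow_finrank_sub_one_mul_rpow E hr]
      ring_nf
    · rw [hf, indicator_of_notMem (fun h => hrt h.2), indicator_of_notMem (fun h => hrt h.2),
        mul_zero]
  have hi : IntegrableOn (fun r : ℝ => r ^ (q - 1)) (Ioo 0 t) :=
    (intervalIntegral.integrableOn_Ioo_rpow_iff ht).2 (by linarith)
  have hint : IntegrableOn (fun r => r ^ (Module.finrank ℝ E - 1) * f r) (Ioi 0) := by
    rw [integrableOn_congr_fun heq measurableSet_Ioi]
    exact (IntegrableOn.integrable_indicator hi measurableSet_Ioo).integrableOn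
  have h0 : ∀ r, 0 ≤ f r := fun r => indicator_nonneg
    (fun r hr => Real.rpow_nonneg hr.1 _) r
  have h1 : ∫⁻ h in {h : E | ‖h‖ < t}, ENNReal.ofReal (‖h‖ ^ (q - Module.finrank ℝ E : ℝ)) ∂μ
      = ∫⁻ h : E, ENNReal.ofReal (f ‖h‖) ∂μ := by
    rw [← lintegral_indicator hm]
    refine lintegral_congr fun h => ?_
    by_cases hh : ‖h‖ < t
    · rw [indicator_of_mem (by exact hh), hf, indicator_of_mem (show ‖h‖ ∈ Ico 0 t from ⟨norm_nonneg h, hh⟩)]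
    · rw [indicator_of_notMem (by exact hh), hf, indicator_of_notMem (fun h => hh h.2),
        ENNReal.ofReal_zero]
  rw [h1, lintegral_fun_norm μ h0 hint, setIntegral_congr_fun measurableSet_Ioi heq,
    setIntegral_indicator measurableSet_Ioo, inter_eq_right.2 (Ioo_subset_Ioi_self),
    ← integral_Ioc_eq_integral_Ioo, ← intervalIntegral.integral_of_le ht.le,
    integral_rpow (Or.inl (by linarith)),
    ENNReal.ofNNReal_toNNReal, ← ENNReal.ofReal_mul (by positivity)]
  apply le_of_eq
  congr 1
  rw [sub_add_cancel, Real.zero_rpow hq.ne']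
  ring

end PowerIntegrals

/-! ### Schur's test for square integrals. -/

section Schur

variable {α β : Type*} [MeasurableSpace α] [MeasurableSpace β]

/-- Cauchy–Schwarz for the factorisation of `A V` into `(A w⁻¹) ^ (1/2)` and `(A w V²) ^ (1/2)`,
which is valid wherever `w` is neither `0` nor `∞`. -/
lemma sq_lintegral_mul_le (μ : Measure α) {A V w : α → ℝ≥0∞} (hA : AEMeasurable A μ)
    (hV : AEMeasurable V μ) (hw : AEMeasurable w μ) (h0 : ∀ᵐ p ∂μ, w p ≠ 0)
    (htop : ∀ᵐ p ∂μ, w p ≠ ∞) :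
    (∫⁻ p, A p * V p ∂μ) ^ 2 ≤ (∫⁻ p, A p * (w p)⁻¹ ∂μ) * ∫⁻ p, A p * (w p * V p ^ 2) ∂μ := by
  have hg : AEMeasurable (fun p => (A p * (w p * V p ^ 2)) ^ (1 / 2 : ℝ)) μ := by fun_prop
  have key := ENNReal.lintegral_mul_le_Lp_mul_Lq μ Real.HolderConjugate.two_two
    (f := fun p => (A p * (w p)⁻¹) ^ (1 / 2 : ℝ)) (g := fun p => (A p * (w p * V p ^ 2)) ^ (1 / 2 : ℝ))
    ((hA.mul hw.inv).pow_const _) hg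
  have hsq : ∀ a : ℝ≥0∞, (a ^ (1 / 2 : ℝ)) ^ (2 : ℝ) = a := fun a => by
    rw [← ENNReal.rpow_mul]; norm_num
  simp only [hsq] at key
  have heq : ∫⁻ p, A p * V p ∂μ = ∫⁻ p, ((fun p => (A p * (w p)⁻¹) ^ (1 / 2 : ℝ)) *
      fun p => (A p * (w p * V p ^ 2)) ^ (1 / 2 : ℝ)) p ∂μ := by
    refine lintegral_congr_ae ?_
    filter_upwards [h0, htop] with p hp0 hpt
    simp only [Pi.mul_apply]
    rw [← ENNReal.mul_rpow_of_nonneg _ _ (by norm_num : (0 : ℝ) ≤ 1 / 2),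
      show A p * (w p)⁻¹ * (A p * (w p * V p ^ 2)) = (w p)⁻¹ * w p * (A p * V p) ^ 2 by ring,
      ENNReal.inv_mul_cancel hp0 hpt, one_mul, ← ENNReal.rpow_natCast, ← ENNReal.rpow_mul]
    norm_num
  rw [heq]
  calc _ ≤ _ := pow_le_pow_left' key 2
    _ = _ := by
      rw [mul_pow, ← ENNReal.rpow_natCast, ← ENNReal.rpow_natCast, ← ENNReal.rpow_mul,
        ← ENNReal.rpow_mul]
      norm_num

/-- Schur's test in weighted form, for square integrals. -/
lemma lintegral_mul_sq_lintegral_le (μ : Measure α) (ν : Measure β) [SFinite μ] [SFinite ν]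
    {A : β → α → ℝ≥0∞} {V w ρ : α → ℝ≥0∞} {κ M : β → ℝ≥0∞}
    (hA : Measurable (Function.uncurry A)) (hV : Measurable V) (hw : Measurable w)
    (hκ : Measurable κ) (hM : Measurable M)
    (h0 : ∀ᵐ p ∂μ, w p ≠ 0) (htop : ∀ᵐ p ∂μ, w p ≠ ∞)
    (h1 : ∀ h, ∫⁻ p, A h p * (w p)⁻¹ ∂μ ≤ M h)
    (h2 : ∀ᵐ p ∂μ, w p * ∫⁻ h, κ h * M h * A h p ∂ν ≤ ρ p) :
    ∫⁻ h, κ h * (∫⁻ p, A h p * V p ∂μ) ^ 2 ∂ν ≤ ∫⁻ p, ρ p * V p ^ 2 ∂μ := by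
  have hAh : ∀ h, Measurable (A h) := fun h => hA.comp measurable_prodMk_left
  have hm : Measurable (Function.uncurry fun h p => κ h * M h * A h p * (w p * V p ^ 2)) := 
    (((hκ.comp measurable_fst).mul (hM.comp measurable_fst)).mul hA).mul
      ((hw.comp measurable_snd).mul ((hV.comp measurable_snd).pow_const 2))
  calc ∫⁻ h, κ h * (∫⁻ p, A h p * V p ∂μ) ^ 2 ∂ν
      ≤ ∫⁻ h, ∫⁻ p, κ h * M h * A h p * (w p * V p ^ 2) ∂μ ∂ν := by
        refine lintegral_mono fun h => ?_
        calc _ ≤ κ h * ((∫⁻ p, A h p * (w p)⁻¹ ∂μ) * ∫⁻ p, A h p * (w p * V p ^ 2) ∂μ) := by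
              gcongr
              exact sq_lintegral_mul_le μ (hAh h).aemeasurable hV.aemeasurable hw.aemeasurable h0 htop
          _ ≤ κ h * (M h * ∫⁻ p, A h p * (w p * V p ^ 2) ∂μ) := by gcongr; exact h1 h
          _ = _ := by
              rw [← mul_assoc, ← lintegral_const_mul]
              · simp only [mul_assoc]
              · exact (hAh h).mul (hw.mul (hV.pow_const 2))
    -- With the inner factor replaced by its bound `M h`, Tonelli leaves an integral in `h` alone,
    -- which is what `h2` controls.
    _ = ∫⁻ p, ∫⁻ h, κ h * M h * A h p * (w p * V p ^ 2) ∂ν ∂μ :=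
        lintegral_lintegral_swap hm.aemeasurable
    _ ≤ _ := by
        refine lintegral_mono_ae ?_
        filter_upwards [h2] with p hp
        rw [lintegral_mul_const]
        · calc _ = w p * (∫⁻ h, κ h * M h * A h p ∂ν) * V p ^ 2 := by ring
            _ ≤ _ := by gcongr
        · exact (hκ.mul hM).mul (hA.comp measurable_prodMk_right)

end Schur

/-! ### Three truncated power kernels, bounded by the weight of `g*`. -/

section TruncatedKernels

variable {E : Type*} [NormedAddCommGroup E]

/-- The weight of the square function `g*` with exponent `κ`, in dimension `d`. -/
noncomputable def coneWeight (d κ : ℝ) (p : ℝ × E) : ℝ≥0∞ :=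
  ENNReal.ofReal (p.1 ^ (1 - d) * (p.1 / (p.1 + ‖p.2‖)) ^ κ)

lemma ofReal_rpow_mul_ofReal_rpow {r : ℝ} (hr : 0 < r) (a b : ℝ) :
    ENNReal.ofReal (r ^ a) * ENNReal.ofReal (r ^ b) = ENNReal.ofReal (r ^ (a + b)) := by
  rw [← ENNReal.ofReal_mul (by positivity), Real.rpow_add hr]

/-- Here `F t` stands for the volume of a slice at height `t`, of order `t ^ d`, so everything
reduces to the integral of `t ^ (ε - 1)` over `(0, R]`. Convergence at `0` is the reason for `ε`. -/
lemma lintegral_near_le {d ε : ℝ} (hε : 0 < ε) {ω : ℝ≥0} {R : ℝ} (hR : 0 < R) {F : ℝ → ℝ≥0∞}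
    (h0 : ∀ t, R < t → F t = 0) (hF : ∀ t, 0 < t → F t ≤ ω * ENNReal.ofReal (t ^ d)) :
    ∫⁻ t in Ioi 0, ENNReal.ofReal (t ^ (ε - 1 - d)) * F t ≤
      (ω * (1 / ε).toNNReal : ℝ≥0) * ENNReal.ofReal (R ^ ε) := by
  calc _ ≤ ∫⁻ t in Ioi 0, (Ioc 0 R).indicator (fun t => ω * ENNReal.ofReal (t ^ (ε - 1))) t := by
        refine setLIntegral_mono' measurableSet_Ioi fun t (ht : 0 < t) => ?_
        by_cases htR : t ≤ R
        · rw [indicator_of_mem (show t ∈ Ioc 0 R from ⟨ht, htR⟩)]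
          calc _ ≤ ENNReal.ofReal (t ^ (ε - 1 - d)) * (ω * ENNReal.ofReal (t ^ d)) :=
                mul_le_mul_right (hF t ht) _
            _ = ω * (ENNReal.ofReal (t ^ (ε - 1 - d)) * ENNReal.ofReal (t ^ d)) := by ring
            _ = _ := by rw [ofReal_rpow_mul_ofReal_rpow ht, sub_add_cancel]
        · rw [h0 t (not_le.1 htR), mul_zero]
          exact zero_le
    _ ≤ ∫⁻ t, (Ioc 0 R).indicator (fun t => ω * ENNReal.ofReal (t ^ (ε - 1))) t :=
        setLIntegral_le_lintegral _ _
    _ = _ := by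
        rw [lintegral_indicator measurableSet_Ioc, lintegral_const_mul' _ _ ENNReal.coe_ne_top,
          setLIntegral_Iio_rpow hε hR, div_eq_mul_one_div, mul_comm (R ^ ε),
          ENNReal.ofReal_mul (by positivity)]
        push_cast
        rw [ENNReal.ofNNReal_toNNReal]
        ring

/-- The counterpart for slices that are empty up to height `R`: what remains is the integral of `t ^
(-p - 1)` over `(R, ∞)`. -/
lemma lintegral_far_le {d p : ℝ} (hp : 0 < p) {ω : ℝ≥0} {R : ℝ} (hR : 0 < R) {F : ℝ → ℝ≥0∞}
    (h0 : ∀ t, t ≤ R → F t = 0) (hF : ∀ t, 0 < t → F t ≤ ω * ENNReal.ofReal (t ^ d)) :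
    ∫⁻ t in Ioi 0, ENNReal.ofReal (t ^ (-p - 1 - d)) * F t ≤
      (ω * (1 / p).toNNReal : ℝ≥0) * ENNReal.ofReal (R ^ (-p)) := by
  calc _ ≤ ∫⁻ t in Ioi 0, (Ioi R).indicator (fun t => ω * ENNReal.ofReal (t ^ (-p - 1))) t := by
        refine setLIntegral_mono' measurableSet_Ioi fun t (ht : 0 < t) => ?_
        by_cases htR : R < t
        · rw [indicator_of_mem (show t ∈ Ioi R from htR)]
          calc _ ≤ ENNReal.ofReal (t ^ (-p - 1 - d)) * (ω * ENNReal.ofReal (t ^ d)) :=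
                mul_le_mul_right (hF t ht) _
            _ = ω * (ENNReal.ofReal (t ^ (-p - 1 - d)) * ENNReal.ofReal (t ^ d)) := by ring
            _ = _ := by rw [ofReal_rpow_mul_ofReal_rpow ht, sub_add_cancel]
        · rw [h0 t (not_lt.1 htR), mul_zero]
          exact zero_le
    _ ≤ ∫⁻ t, (Ioi R).indicator (fun t => ω * ENNReal.ofReal (t ^ (-p - 1))) t :=
        setLIntegral_le_lintegral _ _
    _ = _ := by
        rw [lintegral_indicator measurableSet_Ioi, lintegral_const_mul' _ _ ENNReal.coe_ne_top,
          setLIntegral_Ioi_rpow hp hR, div_eq_mul_one_div, mul_comm (R ^ (-p)),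
          ENNReal.ofReal_mul (by positivity)]
        push_cast
        rw [ENNReal.ofNNReal_toNNReal]
        ring

/-- In the region `|y| ≤ 2 t` the weight of `g*` is comparable to `t ^ (1 - d)`. -/
lemma ofReal_rpow_le_coneWeight {d κ t : ℝ} (hκ : 0 ≤ κ) (ht : 0 < t) {y : E} (hy : ‖y‖ ≤ 2 * t) :
    ENNReal.ofReal (t ^ (1 - d)) ≤ ((3 : ℝ) ^ κ).toNNReal * coneWeight d κ (t, y) := by
  rw [coneWeight, ENNReal.ofNNReal_toNNReal, ← ENNReal.ofReal_mul (by positivity)]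
  refine ENNReal.ofReal_le_ofReal ?_
  have h1 : 1 ≤ (3 * (t / (t + ‖y‖))) ^ κ := by
    refine Real.one_le_rpow ?_ hκ
    rw [← mul_div_assoc, one_le_div (by positivity)]
    linarith
  rw [Real.mul_rpow (by norm_num) (by positivity)] at h1
  calc _ = t ^ (1 - d) * 1 := (mul_one _).symm
    _ ≤ t ^ (1 - d) * (3 ^ κ * (t / (t + ‖y‖)) ^ κ) := by gcongr
    _ = _ := by ring

/-- Takes `R = ‖h‖` and adds the case `h = 0`, in which all slices are empty. The factor `‖h‖ ^ 0`
fits the shape of `schur_power_kernel` with `r = 0`. -/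
lemma lintegral_near_norm_le {d ε : ℝ} (hε : 0 < ε) {ω : ℝ≥0} (h : E) {F : ℝ → ℝ≥0∞}
    (h0 : ∀ t, ‖h‖ < t → F t = 0) (hF : ∀ t, 0 < t → F t ≤ ω * ENNReal.ofReal (t ^ d)) :
    ENNReal.ofReal (‖h‖ ^ (0 : ℝ)) * ∫⁻ t in Ioi 0, ENNReal.ofReal (t ^ (ε - 1 - d)) * F t ≤
      (ω * (1 / ε).toNNReal : ℝ≥0) * ENNReal.ofReal (‖h‖ ^ ε) := by
  rw [Real.rpow_zero, ENNReal.ofReal_one, one_mul]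
  rcases eq_or_ne h 0 with rfl | hh
  · refine le_of_eq_of_le ?_ (zero_le)
    rw [setLIntegral_congr_fun (g := fun _ => 0) measurableSet_Ioi fun t (ht : 0 < t) => ?_]
    · simp
    · simp [h0 t (by simpa using ht)]
  · exact lintegral_near_le hε (norm_pos_iff.2 hh) h0 hF

variable [NormedSpace ℝ E] [FiniteDimensional ℝ E] [MeasurableSpace E] [BorelSpace E]

/-- Schur's test for the kernel `t ^ b |h| ^ r` cut off to `S`, with test weight `w = t ^ a` and `M
h` of size `|h| ^ e`. Each application then only needs exponents `a`, `e` for which the two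
one-sided integrals `h1` and `h2` converge. -/
lemma schur_power_kernel (μ : Measure E) [μ.IsAddHaarMeasure] {S : E → ℝ × E → Prop}
    [∀ h p, Decidable (S h p)]
    (hS : MeasurableSet {x : E × ℝ × E | S x.1 x.2}) {a b r e m : ℝ} {C₁ C₂ : ℝ≥0}
    {ρ : ℝ × E → ℝ≥0∞} (hm : m ≠ 0)
    (h1 : ∀ h, ENNReal.ofReal (‖h‖ ^ r) * ∫⁻ t in Ioi (0 : ℝ),
      ENNReal.ofReal (t ^ (b - a)) * μ {y | S h (t, y)} ≤ C₁ * ENNReal.ofReal (‖h‖ ^ e))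
    (h2 : ∀ t, 0 < t → ∀ y, ENNReal.ofReal (t ^ (a + b)) *
      ∫⁻ h in {h | S h (t, y)}, ENNReal.ofReal (‖h‖ ^ (m + e + r)) ∂μ ≤ C₂ * ρ (t, y))
    {V : ℝ × E → ℝ≥0∞} (hV : Measurable V) :
    ∫⁻ h, ENNReal.ofReal (‖h‖ ^ m) * (∫⁻ p, (if S h p then
        ENNReal.ofReal (p.1 ^ b) * ENNReal.ofReal (‖h‖ ^ r) else 0) * V p
        ∂(volume.restrict (Ioi 0)).prod μ) ^ 2 ∂μ ≤
      (C₁ * C₂ : ℝ≥0) * ∫⁻ p, ρ p * V p ^ 2 ∂(volume.restrict (Ioi 0)).prod μ := by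
  have hpos : ∀ᵐ p ∂(volume.restrict (Ioi (0 : ℝ))).prod μ, 0 < p.1 :=
    Measure.quasiMeasurePreserving_fst.ae (ae_restrict_mem measurableSet_Ioi)
  rw [← lintegral_const_mul' _ _ ENNReal.coe_ne_top]
  simp_rw [← mul_assoc]
  have hmA : Measurable (Function.uncurry fun (h : E) (p : ℝ × E) => if S h p then
        ENNReal.ofReal (p.1 ^ b) * ENNReal.ofReal (‖h‖ ^ r) else 0) :=
    Measurable.ite hS (by fun_prop) measurable_const
  refine lintegral_mul_sq_lintegral_le _ μ (w := fun p => ENNReal.ofReal (p.1 ^ a))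
    (M := fun h => C₁ * ENNReal.ofReal (‖h‖ ^ e))
    hmA hV (by fun_prop) (by fun_prop) (by fun_prop) ?_ (by simp) ?_ ?_
  · filter_upwards [hpos] with p hp
    exact (ENNReal.ofReal_pos.2 (Real.rpow_pos_of_pos hp a)).ne'
  · intro h
    refine le_trans (le_of_eq ?_) (h1 h)
    have hmh : Measurable fun p : ℝ × E => if S h p then
        ENNReal.ofReal (p.1 ^ b) * ENNReal.ofReal (‖h‖ ^ r) else 0 :=
      hmA.comp measurable_prodMk_left
    rw [lintegral_prod _ (by fun_prop), ← lintegral_const_mul' _ _ ENNReal.ofReal_ne_top]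
    refine setLIntegral_congr_fun measurableSet_Ioi fun t ht => ?_
    have hSt : MeasurableSet {y | S h (t, y)} :=
      hS.preimage (measurable_prodMk_left.comp measurable_prodMk_left)
    have hta : (ENNReal.ofReal (t ^ a))⁻¹ = ENNReal.ofReal (t ^ (-a)) := by
      rw [Real.rpow_neg (le_of_lt ht), ENNReal.ofReal_inv_of_pos (Real.rpow_pos_of_pos ht a)]
    calc _ = ∫⁻ y, {y | S h (t, y)}.indicator (fun _ => ENNReal.ofReal (t ^ b) *
          ENNReal.ofReal (‖h‖ ^ r) * ENNReal.ofReal (t ^ (-a))) y ∂μ := by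
          refine lintegral_congr fun y => ?_
          simp only [indicator, mem_ofPred_eq, hta]
          split_ifs <;> simp
      _ = _ := by
          rw [lintegral_indicator_const hSt, sub_eq_add_neg, ← ofReal_rpow_mul_ofReal_rpow ht]
          ring
  · filter_upwards [hpos] with p hp
    have hSp : MeasurableSet {h | S h p} := hS.preimage measurable_prodMk_right
    have hle : ∀ h, ENNReal.ofReal (‖h‖ ^ m) * (C₁ * ENNReal.ofReal (‖h‖ ^ e)) * (if S h p then
        ENNReal.ofReal (p.1 ^ b) * ENNReal.ofReal (‖h‖ ^ r) else 0) ≤ 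
        C₁ * ENNReal.ofReal (p.1 ^ b) *
          {h | S h p}.indicator (fun h => ENNReal.ofReal (‖h‖ ^ (m + e + r))) h := by
      intro h
      by_cases hh : S h p
      · rw [if_pos hh, indicator_of_mem (show h ∈ {h | S h p} from hh)]
        -- Exponents of `‖h‖` add only for `h ≠ 0`; at the origin the left side vanishes because `m
        -- ≠ 0`.
        rcases eq_or_ne h 0 with rfl | h0
        · simp [Real.zero_rpow hm]
        · rw [← ofReal_rpow_mul_ofReal_rpow (norm_pos_iff.2 h0),
            ← ofReal_rpow_mul_ofReal_rpow (norm_pos_iff.2 h0)]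
          apply le_of_eq
          ring
      · simp [hh]
    calc _ ≤ ENNReal.ofReal (p.1 ^ a) * ∫⁻ h, C₁ * ENNReal.ofReal (p.1 ^ b) *
          {h | S h p}.indicator (fun h => ENNReal.ofReal (‖h‖ ^ (m + e + r))) h ∂μ := by
          exact mul_le_mul_right (lintegral_mono hle) _
      _ = C₁ * (ENNReal.ofReal (p.1 ^ (a + b)) *
          ∫⁻ h in {h | S h p}, ENNReal.ofReal (‖h‖ ^ (m + e + r)) ∂μ) := by
          rw [lintegral_const_mul' _ _ (by finiteness), lintegral_indicator hSp,
            ← ofReal_rpow_mul_ofReal_rpow hp]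
          ring
      _ ≤ C₁ * (C₂ * ρ p) := mul_le_mul_right (h2 p.1 hp p.2) _
      _ = _ := by push_cast; ring

lemma measure_norm_add_le (μ : Measure E) [μ.IsAddHaarMeasure] (h : E) {t : ℝ} (ht : 0 < t) :
    μ {y | ‖y + h‖ ≤ t} =
      ((μ (Metric.ball 0 1)).toNNReal : ℝ≥0∞) * ENNReal.ofReal (t ^ (Module.finrank ℝ E : ℝ)) := by
  rw [ENNReal.coe_toNNReal measure_ball_lt_top.ne, Real.rpow_natCast, mul_comm,
    ← Measure.addHaar_closedBall μ (-h) ht.le]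
  congr 1
  ext y
  simp [dist_eq_norm]

variable [Nontrivial E]

/-- With `a = 1` and `e = σ`, integrating `t ^ (σ - 2)` over `t > |h|` gives `|h| ^ (σ - 1)`, which
needs `σ < 1`; integrating `|h| ^ (1 - σ - d)` over `|h| < t` gives `t ^ (1 - σ)`. The resulting
weight is `t ^ (1 - d)` on `|y| ≤ 2t`, so any `κ ≥ 0` will do. -/
lemma exists_far_kernel_le (μ : Measure E) [μ.IsAddHaarMeasure] {σ κ : ℝ} (hσ0 : 0 < σ)
    (hσ : σ < 1) (hκ : 0 ≤ κ) :
    ∃ C : ℝ≥0, ∀ V : ℝ × E → ℝ≥0∞, Measurable V →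
      ∫⁻ h, ENNReal.ofReal (‖h‖ ^ (-Module.finrank ℝ E - 2 * σ : ℝ)) *
        (∫⁻ p, (if ‖h‖ < p.1 ∧ ‖p.2‖ ≤ 2 * p.1 then
          ENNReal.ofReal (p.1 ^ (σ - Module.finrank ℝ E - 1)) * ENNReal.ofReal (‖h‖ ^ (1 : ℝ)) else 0)
          * V p ∂(volume.restrict (Ioi 0)).prod μ) ^ 2 ∂μ ≤
      C * ∫⁻ p, coneWeight (Module.finrank ℝ E) κ p * V p ^ 2
        ∂(volume.restrict (Ioi 0)).prod μ := by
  set d : ℝ := ((Module.finrank ℝ E : ℕ) : ℝ) with hd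
  have hd0 : 0 < d := Nat.cast_pos.2 Module.finrank_pos
  obtain ⟨c, hc⟩ := exists_lintegral_norm_lt_le μ (q := 1 - σ) (by linarith)
  set ω : ℝ≥0 := (μ (Metric.ball 0 1)).toNNReal * (2 ^ d : ℝ).toNNReal
  refine ⟨_, fun V hV => schur_power_kernel μ
    (S := fun h p => ‖h‖ < p.1 ∧ ‖p.2‖ ≤ 2 * p.1) ?_ (a := 1) (e := σ)
    (C₁ := ω * (1 / (1 - σ)).toNNReal) (C₂ := c * ((3 : ℝ) ^ κ).toNNReal) ?_ ?_ ?_ hV⟩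
  · have m1 : MeasurableSet {x : E × ℝ × E | ‖x.1‖ < x.2.1} := measurableSet_lt (by fun_prop) (by fun_prop)
    have m2 : MeasurableSet {x : E × ℝ × E | ‖x.2.2‖ ≤ 2 * x.2.1} := measurableSet_le (by fun_prop) (by fun_prop)
    exact m1.inter m2
  · linarith
  · intro h
    rcases eq_or_ne h 0 with rfl | hh
    · simp
    · have := lintegral_far_le (d := d) (p := 1 - σ) (by linarith) (ω := ω) (norm_pos_iff.2 hh)
        (F := fun t => μ {y | ‖h‖ < t ∧ ‖y‖ ≤ 2 * t}) (fun t ht => by simp [not_lt.2 ht])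
        (fun t ht => by
          refine (measure_mono (t := {y | ‖y + 0‖ ≤ 2 * t}) fun y hy => by simpa using hy.2).trans ?_
          rw [measure_norm_add_le μ 0 (by positivity : 0 < 2 * t), ← hd,
            Real.mul_rpow (by norm_num) ht.le, ENNReal.ofReal_mul (by positivity)]
          simp only [ω]
          push_cast
          rw [ENNReal.ofNNReal_toNNReal (2 ^ d), mul_assoc])
      have e1 : σ - d - 1 - 1 = -(1 - σ) - 1 - d := by ring
      rw [e1]
      refine (mul_le_mul_right this _).trans (le_of_eq ?_)
      rw [mul_left_comm, ofReal_rpow_mul_ofReal_rpow (norm_pos_iff.2 hh)]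
      congr 3
      ring
  · intro t ht y
    by_cases hy : ‖y‖ ≤ 2 * t
    · have e1 : -d - 2 * σ + σ + 1 = 1 - σ - d := by ring
      have e2 : {h : E | ‖h‖ < t ∧ ‖y‖ ≤ 2 * t} = {h | ‖h‖ < t} := by ext; simp [hy]
      simp only
      rw [e1, e2]
      refine (mul_le_mul_right (hc t ht) _).trans ?_
      rw [mul_left_comm, ofReal_rpow_mul_ofReal_rpow ht]
      push_cast
      rw [mul_assoc]
      refine mul_le_mul_right ?_ _
      convert! ofReal_rpow_le_coneWeight (d := d) hκ ht hy using 3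
      ring
    · simp [hy]

/-- With `a = σ + 1 - ε` and `e = ε`, the integral of `t ^ (ε - 1)` over `t ≤ |h|` gives `|h| ^ ε`,
and that of `|h| ^ (-d - 2σ + ε)` over `|h| ≥ t` gives `t ^ (ε - 2σ)`, which needs `ε < 2σ`. The
weight is again `t ^ (1 - d)` over a cone. -/
lemma exists_near_kernel_le (μ : Measure E) [μ.IsAddHaarMeasure] {σ ε : ℝ} (hε : 0 < ε)
    (hεσ : ε < 2 * σ) :
    ∃ C : ℝ≥0, ∀ V : ℝ × E → ℝ≥0∞, Measurable V →
      ∫⁻ h, ENNReal.ofReal (‖h‖ ^ (-Module.finrank ℝ E - 2 * σ : ℝ)) *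
        (∫⁻ p, (if p.1 ≤ ‖h‖ ∧ ‖p.2‖ ≤ p.1 then
          ENNReal.ofReal (p.1 ^ (σ - Module.finrank ℝ E)) * ENNReal.ofReal (‖h‖ ^ (0 : ℝ)) else 0)
          * V p ∂(volume.restrict (Ioi 0)).prod μ) ^ 2 ∂μ ≤
      C * ∫⁻ p, coneWeight (Module.finrank ℝ E) (Module.finrank ℝ E + 2 * σ - ε) p * V p ^ 2
        ∂(volume.restrict (Ioi 0)).prod μ := by
  set d : ℝ := ((Module.finrank ℝ E : ℕ) : ℝ) with hd
  have hd0 : 0 < d := Nat.cast_pos.2 Module.finrank_pos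
  obtain ⟨c, hc⟩ := exists_lintegral_norm_ge_le μ (q := 2 * σ - ε) (by linarith)
  set ω : ℝ≥0 := (μ (Metric.ball 0 1)).toNNReal
  refine ⟨_, fun V hV => schur_power_kernel μ
    (S := fun h p => p.1 ≤ ‖h‖ ∧ ‖p.2‖ ≤ p.1) ?_ (a := σ + 1 - ε) (e := ε)
    (C₁ := ω * (1 / ε).toNNReal) (C₂ := c * ((3 : ℝ) ^ (d + 2 * σ - ε)).toNNReal) ?_ ?_ ?_ hV⟩
  · have m1 : MeasurableSet {x : E × ℝ × E | x.2.1 ≤ ‖x.1‖} := measurableSet_le (by fun_prop) (by fun_prop)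
    have m2 : MeasurableSet {x : E × ℝ × E | ‖x.2.2‖ ≤ x.2.1} := measurableSet_le (by fun_prop) (by fun_prop)
    exact m1.inter m2
  · linarith
  · intro h
    rw [show σ - d - (σ + 1 - ε) = ε - 1 - d by ring]
    refine lintegral_near_norm_le hε h (fun t ht => by simp [not_le.2 ht]) fun t ht => ?_
    refine (measure_mono (t := {y | ‖y + 0‖ ≤ t}) fun y hy => by simpa using hy.2).trans ?_
    rw [measure_norm_add_le μ 0 ht]
  · intro t ht y
    by_cases hy : ‖y‖ ≤ t
    · have e1 : -d - 2 * σ + ε + 0 = -d - (2 * σ - ε) := by ring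
      have e2 : {h : E | t ≤ ‖h‖ ∧ ‖y‖ ≤ t} = {h | t ≤ ‖h‖} := by ext; simp [hy]
      simp only
      rw [e1, e2]
      refine (mul_le_mul_right (hc t ht) _).trans ?_
      rw [mul_left_comm, ofReal_rpow_mul_ofReal_rpow ht]
      push_cast
      rw [mul_assoc]
      refine mul_le_mul_right ?_ _
      convert! ofReal_rpow_le_coneWeight (d := d) (κ := d + 2 * σ - ε) (by linarith) ht
        (show ‖y‖ ≤ 2 * t by linarith) using 3
      ring
    · simp [hy]

/-- Now `y` may lie far outside the cone. From `t ≤ |h|` and `|y + h| ≤ t` follows `t + |y| ≤ 3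
|h|`, so `|h| ^ (-κ)` is at most a constant times `(t + |y|) ^ (-κ)` with `κ = d + 2σ - ε`. The
admissible `h` fill a set of volume at most of order `t ^ d`, and the product of all factors is the
weight of `g*` with exponent `κ`. This piece limits the admissible `λ`. -/
lemma exists_near_translated_kernel_le (μ : Measure E) [μ.IsAddHaarMeasure] {σ ε : ℝ} (hε : 0 < ε)
    (hεσ : ε < 2 * σ) :
    ∃ C : ℝ≥0, ∀ V : ℝ × E → ℝ≥0∞, Measurable V →
      ∫⁻ h, ENNReal.ofReal (‖h‖ ^ (-Module.finrank ℝ E - 2 * σ : ℝ)) *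
        (∫⁻ p, (if p.1 ≤ ‖h‖ ∧ ‖p.2 + h‖ ≤ p.1 then
          ENNReal.ofReal (p.1 ^ (σ - Module.finrank ℝ E)) * ENNReal.ofReal (‖h‖ ^ (0 : ℝ)) else 0)
          * V p ∂(volume.restrict (Ioi 0)).prod μ) ^ 2 ∂μ ≤
      C * ∫⁻ p, coneWeight (Module.finrank ℝ E) (Module.finrank ℝ E + 2 * σ - ε) p * V p ^ 2
        ∂(volume.restrict (Ioi 0)).prod μ := by
  set d : ℝ := ((Module.finrank ℝ E : ℕ) : ℝ) with hd
  have hd0 : 0 < d := Nat.cast_pos.2 Module.finrank_pos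
  set ω : ℝ≥0 := (μ (Metric.ball 0 1)).toNNReal
  set κ : ℝ := d + 2 * σ - ε with hκ
  have hκ0 : 0 ≤ κ := by linarith
  refine ⟨_, fun V hV => schur_power_kernel μ
    (S := fun h p => p.1 ≤ ‖h‖ ∧ ‖p.2 + h‖ ≤ p.1) ?_ (a := σ + 1 - ε) (e := ε)
    (C₁ := ω * (1 / ε).toNNReal) (C₂ := ω * ((3 : ℝ) ^ κ).toNNReal) ?_ ?_ ?_ hV⟩
  · have m1 : MeasurableSet {x : E × ℝ × E | x.2.1 ≤ ‖x.1‖} := measurableSet_le (by fun_prop) (by fun_prop)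
    have m2 : MeasurableSet {x : E × ℝ × E | ‖x.2.2 + x.1‖ ≤ x.2.1} := measurableSet_le (by fun_prop) (by fun_prop)
    exact m1.inter m2
  · linarith
  · intro h
    rw [show σ - d - (σ + 1 - ε) = ε - 1 - d by ring]
    refine lintegral_near_norm_le hε h (fun t ht => by simp [not_le.2 ht]) fun t ht => ?_
    refine (measure_mono (t := {y | ‖y + h‖ ≤ t}) fun y hy => hy.2).trans ?_
    rw [measure_norm_add_le μ h ht]
  · intro t ht y
    set ρ : ℝ := t + ‖y‖ with hρ
    have hρ0 : 0 < ρ := by positivity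
    have hle : ∫⁻ h in {h | t ≤ ‖h‖ ∧ ‖y + h‖ ≤ t}, ENNReal.ofReal (‖h‖ ^ (-d - 2 * σ + ε + 0)) ∂μ ≤
        ENNReal.ofReal ((ρ / 3) ^ (-κ)) * (ω * ENNReal.ofReal (t ^ d)) := by
      rw [← measure_norm_add_le μ y ht, ← setLIntegral_const]
      have m1 : MeasurableSet {h : E | t ≤ ‖h‖} := measurableSet_le (by fun_prop) (by fun_prop)
      have m2 : MeasurableSet {h : E | ‖y + h‖ ≤ t} := measurableSet_le (by fun_prop) (by fun_prop)
      have hm : MeasurableSet {h : E | t ≤ ‖h‖ ∧ ‖y + h‖ ≤ t} := m1.inter m2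
      refine (setLIntegral_mono' hm (g := fun _ => ENNReal.ofReal ((ρ / 3) ^ (-κ)))
        fun h hh => ?_).trans
          (lintegral_mono_set fun h hh => by simpa [add_comm] using hh.2)
      refine ENNReal.ofReal_le_ofReal ?_
      rw [show -d - 2 * σ + ε + 0 = -κ by rw [hκ]; ring]
      refine Real.rpow_le_rpow_of_nonpos (by positivity) ?_ (by linarith)
      have h1 := norm_sub_norm_le y (-h)
      rw [sub_neg_eq_add, norm_neg] at h1
      have h2 := hh.1
      have h3 := hh.2
      rw [hρ]
      linarith
    refine (mul_le_mul_right hle _).trans (le_of_eq ?_)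
    rw [coneWeight]
    push_cast
    rw [ENNReal.ofNNReal_toNNReal (3 ^ κ), mul_assoc (ω : ℝ≥0∞), ← ENNReal.ofReal_mul (by positivity),
      mul_left_comm _ (ω : ℝ≥0∞), mul_left_comm _ (ω : ℝ≥0∞),
      ← ENNReal.ofReal_mul (by positivity), ← ENNReal.ofReal_mul (by positivity)]
    congr 2
    simp only [← hρ]
    rw [Real.div_rpow hρ0.le (by norm_num), Real.div_rpow ht.le hρ0.le, Real.rpow_neg hρ0.le,
      Real.rpow_neg (by norm_num), show σ + 1 - ε + (σ - d) = 1 - d + κ - d by rw [hκ]; ring,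
      Real.rpow_sub ht, Real.rpow_add ht]
    have := Real.rpow_pos_of_pos ht d
    have := Real.rpow_pos_of_pos ht κ
    field_simp

end TruncatedKernels

/-! ### The Lipschitz bump and the differences of its dilates. -/

section Tent

variable {E : Type*} [NormedAddCommGroup E]

/-- A radial Lipschitz bump supported in the ball of radius `1 / 4`. -/
noncomputable def tent (y : E) : ℝ := max 0 (1 / 4 - ‖y‖)

lemma tent_nonneg (y : E) : 0 ≤ tent y := le_max_left _ _

lemma tent_le_one (y : E) : tent y ≤ 1 :=
  max_le zero_le_one (by linarith [norm_nonneg y])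

lemma tent_eq_zero {y : E} (hy : 1 / 4 ≤ ‖y‖) : tent y = 0 := max_eq_left (by linarith)

lemma abs_tent_sub_tent_le (y z : E) : |tent y - tent z| ≤ ‖y - z‖ := by
  refine (abs_max_sub_max_le_max 0 _ 0 _).trans ?_
  rw [sub_self, abs_zero, max_eq_right (abs_nonneg _)]
  rw [sub_sub_sub_cancel_left, abs_sub_comm]
  exact abs_norm_sub_norm_le y z

lemma continuous_tent : Continuous (tent : E → ℝ) := by unfold tent; fun_prop

/-- For `|h| < t` the bump is Lipschitz, and both terms vanish once `|y| > 2t`. For `t ≤ |h|` there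
is no cancellation to use and each bump is bounded by the indicator of its ball. The three terms
correspond to the three truncated kernels. -/
lemma abs_tent_sub_tent_inv_smul_le [NormedSpace ℝ E] {t : ℝ} (ht : 0 < t) (y h : E) :
    |tent (t⁻¹ • (y + h)) - tent (t⁻¹ • y)| ≤
      (if ‖h‖ < t ∧ ‖y‖ ≤ 2 * t then ‖h‖ * t⁻¹ else 0) +
      ((if t ≤ ‖h‖ ∧ ‖y‖ ≤ t then 1 else 0) + if t ≤ ‖h‖ ∧ ‖y + h‖ ≤ t then 1 else 0) := by
  have hz : ∀ z : E, t < ‖z‖ → tent (t⁻¹ • z) = 0 := by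
    intro z hz
    refine tent_eq_zero ?_
    rw [norm_smul, norm_inv, Real.norm_of_nonneg ht.le, inv_mul_eq_div, le_div_iff₀ ht]
    linarith
  rcases lt_or_ge ‖h‖ t with hh | hh
  · simp only [hh, true_and, not_le.2 hh, false_and, if_false, add_zero]
    split_ifs with hy
    · refine (abs_tent_sub_tent_le _ _).trans (le_of_eq ?_)
      rw [← smul_sub, add_sub_cancel_left, norm_smul, norm_inv, Real.norm_of_nonneg ht.le, mul_comm]
    · have h1 := norm_sub_norm_le y (-h)
      rw [sub_neg_eq_add, norm_neg] at h1
      rw [hz y (by linarith), hz (y + h) (by linarith)]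
      simp
  · simp only [hh, true_and, not_lt.2 hh, false_and, if_false, zero_add]
    have key : ∀ z : E, tent (t⁻¹ • z) ≤ if ‖z‖ ≤ t then 1 else 0 := by
      intro z
      split_ifs with h1
      · exact tent_le_one _
      · rw [hz z (not_le.1 h1)]
    have := key y
    have := key (y + h)
    have := tent_nonneg (t⁻¹ • y)
    have := tent_nonneg (t⁻¹ • (y + h))
    rw [abs_le]
    constructor <;> linarith

lemma sq_add_add_le (a b c : ℝ≥0∞) : (a + (b + c)) ^ 2 ≤ 9 * (a ^ 2 + (b ^ 2 + c ^ 2)) := by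
  have h : ∀ m, a ≤ m → b ≤ m → c ≤ m → (a + (b + c)) ^ 2 ≤ 9 * m ^ 2 := by
    intro m ha hb hc
    calc (a + (b + c)) ^ 2 ≤ (m + (m + m)) ^ 2 := by gcongr
      _ = _ := by ring
  have h' : ∀ x, x = a ∨ x = b ∨ x = c → 9 * x ^ 2 ≤ 9 * (a ^ 2 + (b ^ 2 + c ^ 2)) := by
    rintro x (rfl | rfl | rfl)
    · exact mul_le_mul_right le_self_add _
    · exact mul_le_mul_right (le_self_add.trans le_add_self) _
    · exact mul_le_mul_right (le_add_self.trans le_add_self) _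
  rcases le_total a b with hab | hab
  · rcases le_total b c with hbc | hbc
    · exact (h c (hab.trans hbc) hbc le_rfl).trans (h' _ (by simp))
    · exact (h b hab le_rfl hbc).trans (h' _ (by simp))
  · rcases le_total a c with hac | hac
    · exact (h c hac (hab.trans hac) le_rfl).trans (h' _ (by simp))
    · exact (h a le_rfl hab hac).trans (h' _ (by simp))

variable [NormedSpace ℝ E] [FiniteDimensional ℝ E] [MeasurableSpace E] [BorelSpace E]
  [Nontrivial E]

/-- The square integral of differences of a potential of `V` is bounded by the integral of
`V ^ 2` against the weight of `g*`. -/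
lemma exists_lintegral_sq_tent_sub_le (μ : Measure E) [μ.IsAddHaarMeasure] {σ ε : ℝ}
    (hσ : σ ∈ Ioo (0 : ℝ) 1) (hε : 0 < ε) (hεσ : ε < 2 * σ) :
    ∃ C : ℝ≥0, ∀ V : ℝ × E → ℝ≥0∞, Measurable V →
      ∫⁻ h, ENNReal.ofReal (‖h‖ ^ (-Module.finrank ℝ E - 2 * σ : ℝ)) *
        (∫⁻ p, ENNReal.ofReal (p.1 ^ (σ - Module.finrank ℝ E) *
          |tent (p.1⁻¹ • (p.2 + h)) - tent (p.1⁻¹ • p.2)|)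
          * V p ∂(volume.restrict (Ioi 0)).prod μ) ^ 2 ∂μ ≤
      C * ∫⁻ p, coneWeight (Module.finrank ℝ E) (Module.finrank ℝ E + 2 * σ - ε) p * V p ^ 2
        ∂(volume.restrict (Ioi 0)).prod μ := by
  set d : ℝ := ((Module.finrank ℝ E : ℕ) : ℝ) with hd
  have hd0 : 0 < d := Nat.cast_pos.2 Module.finrank_pos
  obtain ⟨C₁, h₁⟩ := exists_far_kernel_le μ (κ := d + 2 * σ - ε) hσ.1 hσ.2 (by linarith)
  obtain ⟨C₂, h₂⟩ := exists_near_kernel_le μ hε hεσ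
  obtain ⟨C₃, h₃⟩ := exists_near_translated_kernel_le μ hε hεσ
  rw [← hd] at h₁ h₂ h₃
  refine ⟨9 * (C₁ + (C₂ + C₃)), fun V hV => ?_⟩
  set A₁ : E → ℝ × E → ℝ≥0∞ := fun h p => if ‖h‖ < p.1 ∧ ‖p.2‖ ≤ 2 * p.1 then
    ENNReal.ofReal (p.1 ^ (σ - d - 1)) * ENNReal.ofReal (‖h‖ ^ (1 : ℝ)) else 0 with hA₁
  set A₂ : E → ℝ × E → ℝ≥0∞ := fun h p => if p.1 ≤ ‖h‖ ∧ ‖p.2‖ ≤ p.1 then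
    ENNReal.ofReal (p.1 ^ (σ - d)) * ENNReal.ofReal (‖h‖ ^ (0 : ℝ)) else 0 with hA₂
  set A₃ : E → ℝ × E → ℝ≥0∞ := fun h p => if p.1 ≤ ‖h‖ ∧ ‖p.2 + h‖ ≤ p.1 then
    ENNReal.ofReal (p.1 ^ (σ - d)) * ENNReal.ofReal (‖h‖ ^ (0 : ℝ)) else 0 with hA₃
  have hmA₁ : Measurable (Function.uncurry A₁) := by
    have m1 : MeasurableSet {x : E × ℝ × E | ‖x.1‖ < x.2.1} :=
      measurableSet_lt (by fun_prop) (by fun_prop)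
    have m2 : MeasurableSet {x : E × ℝ × E | ‖x.2.2‖ ≤ 2 * x.2.1} :=
      measurableSet_le (by fun_prop) (by fun_prop)
    exact Measurable.ite (m1.inter m2) (by fun_prop) measurable_const
  have hmA₂ : Measurable (Function.uncurry A₂) := by
    have m1 : MeasurableSet {x : E × ℝ × E | x.2.1 ≤ ‖x.1‖} :=
      measurableSet_le (by fun_prop) (by fun_prop)
    have m2 : MeasurableSet {x : E × ℝ × E | ‖x.2.2‖ ≤ x.2.1} :=
      measurableSet_le (by fun_prop) (by fun_prop)
    exact Measurable.ite (m1.inter m2) (by fun_prop) measurable_const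
  have hpos : ∀ᵐ p ∂(volume.restrict (Ioi (0 : ℝ))).prod μ, 0 < p.1 :=
    Measure.quasiMeasurePreserving_fst.ae (ae_restrict_mem measurableSet_Ioi)
  have hkern : ∀ h, ∀ p : ℝ × E, 0 < p.1 → ENNReal.ofReal (p.1 ^ (σ - d) *
      |tent (p.1⁻¹ • (p.2 + h)) - tent (p.1⁻¹ • p.2)|) ≤ A₁ h p + (A₂ h p + A₃ h p) := by
    intro h p hp
    refine (ENNReal.ofReal_le_ofReal (mul_le_mul_of_nonneg_left
      (abs_tent_sub_tent_inv_smul_le hp p.2 h) (by positivity))).trans ?_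
    rw [mul_add, mul_add]
    refine ENNReal.ofReal_add_le.trans (add_le_add ?_ (ENNReal.ofReal_add_le.trans
      (add_le_add ?_ ?_)))
    · simp only [hA₁]
      split_ifs
      · rw [← ENNReal.ofReal_mul (by positivity), Real.rpow_sub_one hp.ne', Real.rpow_one]
        apply le_of_eq
        congr 1
        ring
      · simp
    · simp only [hA₂]
      split_ifs <;> simp
    · simp only [hA₃]
      split_ifs <;> simp
  have hsplit : ∀ h, (∫⁻ p, ENNReal.ofReal (p.1 ^ (σ - d) *
      |tent (p.1⁻¹ • (p.2 + h)) - tent (p.1⁻¹ • p.2)|) * V p ∂(volume.restrict (Ioi 0)).prod μ) ^ 2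
      ≤ 9 * ((∫⁻ p, A₁ h p * V p ∂(volume.restrict (Ioi 0)).prod μ) ^ 2 +
        ((∫⁻ p, A₂ h p * V p ∂(volume.restrict (Ioi 0)).prod μ) ^ 2 +
        (∫⁻ p, A₃ h p * V p ∂(volume.restrict (Ioi 0)).prod μ) ^ 2)) := by
    intro h
    refine le_trans (pow_le_pow_left' ?_ 2) (sq_add_add_le _ _ _)
    rw [← lintegral_add_left, ← lintegral_add_left]
    · refine lintegral_mono_ae ?_
      filter_upwards [hpos] with p hp
      rw [← add_mul, ← add_mul]
      exact mul_le_mul_left (hkern h p hp) _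
    · exact (hmA₁.comp measurable_prodMk_left).mul hV
    · exact (hmA₂.comp measurable_prodMk_left).mul hV
  have hmI : ∀ A : E → ℝ × E → ℝ≥0∞, Measurable (Function.uncurry A) →
      Measurable fun h => ENNReal.ofReal (‖h‖ ^ (-d - 2 * σ)) *
        (∫⁻ p, A h p * V p ∂(volume.restrict (Ioi 0)).prod μ) ^ 2 := by
    intro A hA
    refine Measurable.mul (by fun_prop) (Measurable.pow_const ?_ 2)
    exact Measurable.lintegral_prod_right' (hA.mul (hV.comp measurable_snd))
  calc _ ≤ ∫⁻ h, 9 * (ENNReal.ofReal (‖h‖ ^ (-d - 2 * σ)) *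
            (∫⁻ p, A₁ h p * V p ∂(volume.restrict (Ioi 0)).prod μ) ^ 2 +
          (ENNReal.ofReal (‖h‖ ^ (-d - 2 * σ)) *
            (∫⁻ p, A₂ h p * V p ∂(volume.restrict (Ioi 0)).prod μ) ^ 2 +
          ENNReal.ofReal (‖h‖ ^ (-d - 2 * σ)) *
            (∫⁻ p, A₃ h p * V p ∂(volume.restrict (Ioi 0)).prod μ) ^ 2)) ∂μ := by
        refine lintegral_mono fun h => (mul_le_mul_right (hsplit h) _).trans (le_of_eq ?_)
        ring
    _ ≤ 9 * ((C₁ * ∫⁻ p, coneWeight d (d + 2 * σ - ε) p * V p ^ 2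
          ∂(volume.restrict (Ioi 0)).prod μ) + ((C₂ * ∫⁻ p, coneWeight d (d + 2 * σ - ε) p * V p ^ 2
          ∂(volume.restrict (Ioi 0)).prod μ) + C₃ * ∫⁻ p, coneWeight d (d + 2 * σ - ε) p * V p ^ 2
          ∂(volume.restrict (Ioi 0)).prod μ)) := by
        rw [lintegral_const_mul' _ _ (by norm_num), lintegral_add_left (hmI A₁ hmA₁),
          lintegral_add_left (hmI A₂ hmA₂)]
        exact mul_le_mul_right (add_le_add (h₁ V hV) (add_le_add (h₂ V hV) (h₃ V hV))) _
    _ = _ := by push_cast; ring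

end Tent

/-! ### Homogeneous radial symbols: second differences and the reproducing formula. -/

section Symbols

variable {E : Type*} [NormedAddCommGroup E] [InnerProductSpace ℝ E]

/-- The reflection exchanging `‖ξ‖ • e` and `ξ` is a linear isometry, so invariance and homogeneity
determine `F` from its value at one unit vector. -/
lemma eq_rpow_norm_smul_of_radial {G : Type*} [AddCommGroup G] [Module ℝ G] {F : E → G} {s : ℝ}
    (hF : ∀ (L : E ≃ₗᵢ[ℝ] E) ξ, F (L ξ) = F ξ) (hs : ∀ c : ℝ, 0 < c → ∀ ξ, F (c • ξ) = c ^ s • F ξ)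
    {e ξ : E} (he : ‖e‖ = 1) (hξ : ξ ≠ 0) : F ξ = ‖ξ‖ ^ s • F e := by
  have hn := norm_pos_iff.2 hξ
  rw [← hs _ hn e]
  have h := Submodule.reflection_sub (v := ‖ξ‖ • e) (w := ξ) (by simp [norm_smul, he])
  conv_lhs => rw [← h]
  exact hF _ _

lemma differenceSymbol_integrand_nonneg (s : ℝ) (ξ h : E) :
    0 ≤ ‖h‖ ^ (-Module.finrank ℝ E - s : ℝ) * (2 - 2 * Real.cos (2 * Real.pi * inner ℝ h ξ)) :=
  mul_nonneg (by positivity) (by linarith [Real.cos_le_one (2 * Real.pi * inner ℝ h ξ)])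

variable [FiniteDimensional ℝ E] [MeasurableSpace E] [BorelSpace E]

/-- The multiplier of the second difference form of `D ^ s`. -/
noncomputable def differenceSymbol (s : ℝ) (ξ : E) : ℝ :=
  ∫ h : E, ‖h‖ ^ (-Module.finrank ℝ E - s : ℝ) * (2 - 2 * Real.cos (2 * Real.pi * inner ℝ h ξ))

/-- Near `0` the quadratic vanishing of `1 - cos` compensates `|h| ^ (-d - s)` because `s < 2`; at
infinity boundedness suffices because `s > 0`. -/
lemma integrable_differenceSymbol [Nontrivial E] {s : ℝ} (hs : s ∈ Ioo (0 : ℝ) 2) (ξ : E) :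
    Integrable fun h : E =>
      ‖h‖ ^ (-Module.finrank ℝ E - s : ℝ) * (2 - 2 * Real.cos (2 * Real.pi * inner ℝ h ξ)) := by
  set d : ℝ := ((Module.finrank ℝ E : ℕ) : ℝ) with hd
  obtain ⟨C₁, h₁⟩ := exists_lintegral_norm_lt_le (volume : Measure E) (q := 2 - s) (by linarith [hs.2])
  obtain ⟨C₂, h₂⟩ := exists_lintegral_norm_ge_le (volume : Measure E) hs.1
  have hm : Measurable fun h : E =>
      ‖h‖ ^ (-d - s) * (2 - 2 * Real.cos (2 * Real.pi * inner ℝ h ξ)) := by fun_prop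
  have hmb : MeasurableSet {h : E | ‖h‖ < 1} := measurableSet_lt (by fun_prop) (by fun_prop)
  rw [← integrableOn_univ, show (univ : Set E) = {h | ‖h‖ < 1} ∪ {h | 1 ≤ ‖h‖} by
    ext h; simp [lt_or_ge]]
  refine IntegrableOn.union ?_ ?_
  · have hi : IntegrableOn (fun h : E => ‖h‖ ^ (2 - s - d)) {h | ‖h‖ < 1} := by
      refine ⟨Measurable.aestronglyMeasurable (by fun_prop), ?_⟩
      rw [hasFiniteIntegral_iff_ofReal (ae_of_all _ fun h => by positivity)]
      exact (h₁ 1 one_pos).trans_lt (by finiteness)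
    refine Integrable.mono' (hi.const_mul ((2 * Real.pi * ‖ξ‖) ^ 2)) hm.aestronglyMeasurable
      (ae_of_all _ fun h => ?_)
    rw [Real.norm_of_nonneg (differenceSymbol_integrand_nonneg s ξ h)]
    rcases eq_or_ne h 0 with rfl | hh
    · simp only [inner_zero_left, mul_zero, Real.cos_zero, mul_one, sub_self]
      positivity
    · have hn := norm_pos_iff.2 hh
      have hc := Real.one_sub_sq_div_two_le_cos (x := 2 * Real.pi * inner ℝ h ξ)
      have hin : (inner ℝ h ξ) ^ 2 ≤ (‖h‖ * ‖ξ‖) ^ 2 :=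
        sq_le_sq' (neg_le_of_abs_le (abs_real_inner_le_norm h ξ)) (real_inner_le_norm h ξ)
      have hb : 2 - 2 * Real.cos (2 * Real.pi * inner ℝ h ξ) ≤ (2 * Real.pi * ‖ξ‖) ^ 2 * ‖h‖ ^ 2 := by
        nlinarith [sq_nonneg Real.pi]
      calc _ ≤ ‖h‖ ^ (-d - s) * ((2 * Real.pi * ‖ξ‖) ^ 2 * ‖h‖ ^ 2) := by gcongr
        _ = (2 * Real.pi * ‖ξ‖) ^ 2 * (‖h‖ ^ (-d - s) * ‖h‖ ^ (2 : ℝ)) := by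
          rw [Real.rpow_two]; ring
        _ = _ := by rw [← Real.rpow_add hn]; ring_nf
  · have hi : IntegrableOn (fun h : E => ‖h‖ ^ (-d - s)) {h | 1 ≤ ‖h‖} := by
      refine ⟨Measurable.aestronglyMeasurable (by fun_prop), ?_⟩
      rw [hasFiniteIntegral_iff_ofReal (ae_of_all _ fun h => by positivity)]
      exact (h₂ 1 one_pos).trans_lt (by finiteness)
    refine Integrable.mono' (hi.const_mul 4) hm.aestronglyMeasurable (ae_of_all _ fun h => ?_)
    rw [Real.norm_of_nonneg (differenceSymbol_integrand_nonneg s ξ h), mul_comm]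
    gcongr
    linarith [Real.neg_one_le_cos (2 * Real.pi * inner ℝ h ξ)]

lemma differenceSymbol_map (s : ℝ) (L : E ≃ₗᵢ[ℝ] E) (ξ : E) :
    differenceSymbol s (L ξ) = differenceSymbol s ξ := by
  unfold differenceSymbol
  rw [← L.measurePreserving.integral_comp L.toHomeomorph.measurableEmbedding]
  simp

lemma differenceSymbol_smul (s : ℝ) {c : ℝ} (hc : 0 < c) (ξ : E) :
    differenceSymbol s (c • ξ) = c ^ s • differenceSymbol s ξ := by
  set d : ℝ := ((Module.finrank ℝ E : ℕ) : ℝ) with hd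
  have h := Measure.integral_comp_smul (volume : Measure E) (fun h : E =>
    ‖h‖ ^ (-d - s) * (2 - 2 * Real.cos (2 * Real.pi * inner ℝ h ξ))) c
  have h2 : ∀ h : E, ‖c • h‖ ^ (-d - s) * (2 - 2 * Real.cos (2 * Real.pi * inner ℝ (c • h) ξ)) =
      c ^ (-d - s) * (‖h‖ ^ (-d - s) * (2 - 2 * Real.cos (2 * Real.pi * inner ℝ h (c • ξ)))) := by
    intro h
    rw [norm_smul, Real.norm_of_nonneg hc.le, Real.mul_rpow hc.le (norm_nonneg h),
      real_inner_smul_left, real_inner_smul_right, mul_assoc]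
  simp_rw [h2] at h
  rw [integral_const_mul, ← Real.rpow_natCast, ← hd, abs_of_nonneg (by positivity),
    ← Real.rpow_neg hc.le, Real.rpow_sub hc, div_mul_eq_mul_div, smul_eq_mul, mul_div_assoc] at h
  have h3 := mul_left_cancel₀ (Real.rpow_pos_of_pos hc _).ne' h
  rw [div_eq_iff (Real.rpow_pos_of_pos hc _).ne'] at h3
  rw [smul_eq_mul, mul_comm]
  exact h3

/-- The nonnegative integrand is nonzero on the open slab `0 < ⟪h, e⟫ < 1`, since `cos (2πx) = 1`
only at integers `x`. -/
lemma differenceSymbol_pos [Nontrivial E] {s : ℝ} (hs : s ∈ Ioo (0 : ℝ) 2) {e : E} (he : ‖e‖ = 1) :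
    0 < differenceSymbol s e := by
  unfold differenceSymbol
  rw [integral_pos_iff_support_of_nonneg (differenceSymbol_integrand_nonneg s e)
    (integrable_differenceSymbol hs e)]
  have hopen : IsOpen {h : E | inner ℝ h e ∈ Ioo (0 : ℝ) 1} := isOpen_Ioo.preimage (by fun_prop)
  refine (hopen.measure_pos volume ⟨(1 / 2 : ℝ) • e, ?_⟩).trans_le (measure_mono fun h hh => ?_)
  · simp [real_inner_smul_left, he]
    norm_num
  · have hh0 : h ≠ 0 := by
      rintro rfl
      simp at hh
    refine mul_ne_zero (Real.rpow_pos_of_pos (norm_pos_iff.2 hh0) _).ne' ?_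
    intro h0
    obtain ⟨k, hk⟩ := (Real.cos_eq_one_iff (2 * Real.pi * inner ℝ h e)).1 (by linarith)
    have hk' : (k : ℝ) = inner ℝ h e := by
      have := Real.pi_pos
      rw [mul_comm] at hk
      exact mul_left_cancel₀ (by positivity) hk
    have h1 : (0 : ℝ) < k := hk' ▸ hh.1
    have h2 : (k : ℝ) < 1 := hk' ▸ hh.2
    norm_cast at h1 h2
    omega

/-- `|ξ| ^ s` as an integral of second differences of characters. -/
lemma exists_differenceSymbol_eq [Nontrivial E] {s : ℝ} (hs : s ∈ Ioo (0 : ℝ) 2) :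
    ∃ c : ℝ, 0 < c ∧ ∀ ξ : E, differenceSymbol s ξ = c * (2 * Real.pi * ‖ξ‖) ^ s := by
  obtain ⟨e, he⟩ := exists_norm_eq E zero_le_one
  have hpi : 0 < 2 * Real.pi := by positivity
  refine ⟨differenceSymbol s e / (2 * Real.pi) ^ s, div_pos (differenceSymbol_pos hs he)
    (by positivity), fun ξ => ?_⟩
  rcases eq_or_ne ξ 0 with rfl | hξ
  · simp [differenceSymbol, Real.zero_rpow hs.1.ne']
  · rw [eq_rpow_norm_smul_of_radial (differenceSymbol_map s)
      (fun c hc ξ => differenceSymbol_smul s hc ξ) he hξ, Real.mul_rpow hpi.le (norm_nonneg _),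
      smul_eq_mul]
    field_simp

/-- The multiplier of the reproducing formula with the bump `tent`. -/
noncomputable def tentSymbol (σ : ℝ) (ξ : E) : ℂ :=
  ∫ t in Ioi (0 : ℝ), (t ^ σ : ℝ) • (𝓕 (fun y : E => (tent y : ℂ)) (t • ξ) *
    ((2 * Real.pi * ‖ξ‖ * Real.exp (-(2 * Real.pi * ‖ξ‖ * t)) : ℝ) : ℂ))

lemma tentSymbol_map (σ : ℝ) (L : E ≃ₗᵢ[ℝ] E) (ξ : E) : tentSymbol σ (L ξ) = tentSymbol σ ξ := by
  have h : ∀ η : E, 𝓕 (fun y : E => (tent y : ℂ)) (L η) = 𝓕 (fun y : E => (tent y : ℂ)) η := by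
    intro η
    rw [← Real.fourier_comp_linearIsometry]
    simp [Function.comp_def, tent]
  unfold tentSymbol
  simp_rw [← L.map_smul, h, L.norm_map]

lemma tentSymbol_smul (σ : ℝ) {c : ℝ} (hc : 0 < c) (ξ : E) :
    tentSymbol σ (c • ξ) = c ^ (-σ) • tentSymbol σ ξ := by
  have h := integral_comp_mul_left_Ioi (fun t : ℝ => (t ^ σ : ℝ) •
    (𝓕 (fun y : E => (tent y : ℂ)) (t • ξ) *
    ((2 * Real.pi * ‖ξ‖ * Real.exp (-(2 * Real.pi * ‖ξ‖ * t)) : ℝ) : ℂ))) 0 hc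
  rw [mul_zero] at h
  change _ = c⁻¹ • tentSymbol σ ξ at h
  have h2 : tentSymbol σ (c • ξ) = (c * c ^ (-σ)) • ∫ t in Ioi (0 : ℝ), ((c * t) ^ σ : ℝ) •
    (𝓕 (fun y : E => (tent y : ℂ)) ((c * t) • ξ) *
    ((2 * Real.pi * ‖ξ‖ * Real.exp (-(2 * Real.pi * ‖ξ‖ * (c * t))) : ℝ) : ℂ)) := by
    rw [← integral_smul]
    refine setIntegral_congr_fun measurableSet_Ioi fun t (ht : 0 < t) => ?_
    rw [norm_smul, Real.norm_of_nonneg hc.le, smul_smul, mul_comm t c, smul_smul,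
      Real.mul_rpow hc.le ht.le, Real.rpow_neg hc.le,
      show c * (c ^ σ)⁻¹ * (c ^ σ * t ^ σ) = t ^ σ * c by
        have := Real.rpow_pos_of_pos hc σ
        field_simp,
      mul_smul, show 2 * Real.pi * (c * ‖ξ‖) * t = 2 * Real.pi * ‖ξ‖ * (c * t) by ring]
    simp only [Complex.real_smul]
    push_cast
    ring
  rw [h2, h, smul_smul, mul_right_comm, mul_inv_cancel₀ hc.ne', one_mul]

lemma integrable_tent : Integrable (tent : E → ℝ) := by
  refine continuous_tent.integrable_of_hasCompactSupport ?_
  refine HasCompactSupport.intro (isCompact_closedBall (0 : E) (1 / 4)) fun y hy => ?_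
  refine tent_eq_zero ?_
  simpa using (not_le.1 (fun h => hy (by simpa using h))).le

lemma integral_tent_pos : 0 < ∫ y : E, tent y := by
  rw [integral_pos_iff_support_of_nonneg tent_nonneg integrable_tent]
  refine (continuous_tent.isOpen_support).measure_pos volume ⟨0, ?_⟩
  simp [tent]

/-- On the support `|y| ≤ 1/4` the phase is at most `2π|ξ|/4` in absolute value, and `cos x ≥ 1 -
|x|`. -/
lemma re_fourier_tent_ge (ξ : E) :
    (1 - 2 * Real.pi * ‖ξ‖ / 4) * ∫ y : E, tent y ≤
      (𝓕 (fun y : E => (tent y : ℂ)) ξ).re := by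
  rw [Real.fourier_eq', ← integral_const_mul]
  have hi : Integrable fun y : E =>
      Complex.exp ((↑(-2 * Real.pi * inner ℝ y ξ) * Complex.I)) • (tent y : ℂ) := by
    refine (integrable_tent (E := E)).mono' ?_ (ae_of_all _ fun y => ?_)
    · have := continuous_tent (E := E)
      exact Continuous.aestronglyMeasurable (by fun_prop)
    · rw [norm_smul, Complex.norm_exp_ofReal_mul_I, one_mul, Complex.norm_real,
        Real.norm_of_nonneg (tent_nonneg y)]
  rw [← RCLike.re_eq_complex_re, ← integral_re hi]
  refine integral_mono (integrable_tent.const_mul _) hi.re fun y => ?_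
  simp only [RCLike.re_eq_complex_re, smul_eq_mul, Complex.re_mul_ofReal,
    Complex.exp_ofReal_mul_I_re]
  rcases le_or_gt (1 / 4) ‖y‖ with hy | hy
  · simp [tent_eq_zero hy]
  · refine mul_le_mul_of_nonneg_right ?_ (tent_nonneg y)
    have h1 := Real.one_sub_sq_div_two_le_cos (x := -2 * Real.pi * inner ℝ y ξ)
    have h2 := Real.neg_one_le_cos (-2 * Real.pi * inner ℝ y ξ)
    have h3 : |(-2 * Real.pi * inner ℝ y ξ)| ≤ 2 * Real.pi * ‖ξ‖ / 4 := by
      rw [abs_mul, abs_mul, abs_neg, abs_two, abs_of_pos Real.pi_pos]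
      have := abs_real_inner_le_norm y ξ
      have : ‖y‖ * ‖ξ‖ ≤ 1 / 4 * ‖ξ‖ := by gcongr
      nlinarith [Real.pi_pos]
    set x := -2 * Real.pi * inner ℝ y ξ
    -- The bound `cos x ≥ 1 - |x|` follows from `1 - x²/2` when `|x| ≤ 2`, and from `-1` otherwise.
    rcases le_total |x| 2 with h4 | h4
    · nlinarith [sq_abs x, abs_nonneg x]
    · linarith

lemma integrableOn_rpow_mul_exp {σ : ℝ} (hσ : -1 < σ) {r : ℝ} (hr : 0 < r) :
    IntegrableOn (fun t : ℝ => t ^ σ * Real.exp (-(r * t))) (Ioi 0) := by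
  have := integrableOn_rpow_mul_exp_neg_mul_rpow hσ one_pos hr
  simpa using this

lemma integral_rpow_mul_exp {σ : ℝ} (hσ : -1 < σ) {r : ℝ} (hr : 0 < r) :
    ∫ t in Ioi (0 : ℝ), t ^ σ * Real.exp (-(r * t)) = (1 / r) ^ (σ + 1) * Real.Gamma (σ + 1) := by
  have := Real.integral_rpow_mul_exp_neg_mul_Ioi (a := σ + 1) (r := r) (by linarith) hr
  simpa using this

lemma norm_fourier_tent_le (ξ : E) : ‖𝓕 (fun y : E => (tent y : ℂ)) ξ‖ ≤ ∫ y : E, tent y := by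
  rw [Real.fourier_eq']
  refine (norm_integral_le_integral_norm _).trans (le_of_eq (integral_congr_ae
    (ae_of_all _ fun y => ?_)))
  simp only
  rw [norm_smul, Complex.norm_exp_ofReal_mul_I, one_mul, Complex.norm_real,
    Real.norm_of_nonneg (tent_nonneg y)]

lemma continuous_fourier_tent : Continuous (𝓕 (fun y : E => (tent y : ℂ))) :=
  VectorFourier.fourierIntegral_continuous Real.continuous_fourierChar
    (by exact continuous_inner) integrable_tent.ofReal

/-- Integrating the lower bound of `re_fourier_tent_ge` against `t ^ σ exp (-2πt)` gives Gamma
integrals, whose combination is a positive multiple of `1 - (σ + 1)/4`. The small radius `1/4` of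
the bump makes this positive. -/
lemma tentSymbol_ne_zero {σ : ℝ} (hσ : σ ∈ Ioo (0 : ℝ) 1) {e : E} (he : ‖e‖ = 1) :
    tentSymbol σ e ≠ 0 := by
  have hpi : 0 < 2 * Real.pi := by positivity
  set I : ℝ := ∫ y : E, tent y with hI
  have hI0 : 0 < I := integral_tent_pos
  have hint := integrableOn_rpow_mul_exp (σ := σ) (by linarith [hσ.1]) hpi
  have hint' := integrableOn_rpow_mul_exp (σ := σ + 1) (by linarith [hσ.1]) hpi
  have hi : IntegrableOn (fun t : ℝ => (t ^ σ : ℝ) • (𝓕 (fun y : E => (tent y : ℂ)) (t • e) *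
      ((2 * Real.pi * ‖e‖ * Real.exp (-(2 * Real.pi * ‖e‖ * t)) : ℝ) : ℂ))) (Ioi 0) := by
    refine Integrable.mono' (hint.const_mul (I * (2 * Real.pi))) ?_
      ((ae_restrict_iff' measurableSet_Ioi).2 (ae_of_all _ fun t (ht : 0 < t) => ?_))
    · have hc : Measurable fun t : ℝ => 𝓕 (fun y : E => (tent y : ℂ)) (t • e) :=
        (continuous_fourier_tent.comp (by fun_prop)).measurable
      exact Measurable.aestronglyMeasurable (by fun_prop)
    · rw [he, mul_one, norm_smul, norm_mul, Complex.norm_real,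
        Real.norm_of_nonneg (by positivity), Real.norm_of_nonneg (by positivity)]
      calc _ ≤ t ^ σ * (I * (2 * Real.pi * Real.exp (-(2 * Real.pi * t)))) := by
            gcongr
            exact norm_fourier_tent_le _
        _ = _ := by ring
  have hlow : ∫ t in Ioi (0 : ℝ), (2 * Real.pi * I * (t ^ σ * Real.exp (-(2 * Real.pi * t))) -
      2 * Real.pi / 4 * (2 * Real.pi * I) * (t ^ (σ + 1) * Real.exp (-(2 * Real.pi * t)))) ≤
      (tentSymbol σ e).re := by
    rw [tentSymbol, ← RCLike.re_eq_complex_re, ← integral_re hi]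
    refine setIntegral_mono_on ((hint.const_mul _).sub (hint'.const_mul _)) hi.re
      measurableSet_Ioi fun t (ht : 0 < t) => ?_
    have h := re_fourier_tent_ge (t • e)
    rw [norm_smul, he, mul_one, Real.norm_of_nonneg ht.le, ← hI] at h
    rw [RCLike.re_eq_complex_re, Complex.smul_re, Complex.re_mul_ofReal, he, mul_one,
      Real.rpow_add_one ht.ne', smul_eq_mul]
    calc _ = t ^ σ * ((1 - 2 * Real.pi * t / 4) * I *
          (2 * Real.pi * Real.exp (-(2 * Real.pi * t)))) := by ring
      _ ≤ _ := by gcongr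
  have hpos : 0 < ∫ t in Ioi (0 : ℝ), (2 * Real.pi * I * (t ^ σ * Real.exp (-(2 * Real.pi * t))) -
      2 * Real.pi / 4 * (2 * Real.pi * I) * (t ^ (σ + 1) * Real.exp (-(2 * Real.pi * t)))) := by
    rw [integral_sub (hint.const_mul _) (hint'.const_mul _), integral_const_mul, integral_const_mul,
      integral_rpow_mul_exp (by linarith [hσ.1]) hpi, integral_rpow_mul_exp (by linarith [hσ.1]) hpi,
      Real.Gamma_add_one (s := σ + 1) (by linarith [hσ.1]),
      Real.rpow_add_one (by positivity : 1 / (2 * Real.pi) ≠ 0) (σ + 1)]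
    have hG := Real.Gamma_pos_of_pos (s := σ + 1) (by linarith [hσ.1])
    have hP : 0 < (1 / (2 * Real.pi)) ^ (σ + 1) := by positivity
    have heq : 2 * Real.pi * I * ((1 / (2 * Real.pi)) ^ (σ + 1) * Real.Gamma (σ + 1)) -
        2 * Real.pi / 4 * (2 * Real.pi * I) * ((1 / (2 * Real.pi)) ^ (σ + 1) * (1 / (2 * Real.pi)) *
          ((σ + 1) * Real.Gamma (σ + 1))) =
        2 * Real.pi * I * ((1 / (2 * Real.pi)) ^ (σ + 1) * Real.Gamma (σ + 1)) *
          (1 - (σ + 1) / 4) := by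
      field_simp
    rw [heq]
    have : 0 < 1 - (σ + 1) / 4 := by linarith [hσ.2]
    positivity
  intro h0
  rw [h0, Complex.zero_re] at hlow
  linarith

/-- `|ξ| ^ (-σ)` as the multiplier of a superposition of dilated bumps applied to the normal
derivative of the Poisson semigroup. -/
lemma exists_tentSymbol_eq [Nontrivial E] {σ : ℝ} (hσ : σ ∈ Ioo (0 : ℝ) 1) :
    ∃ c : ℂ, c ≠ 0 ∧ ∀ ξ : E, ξ ≠ 0 → tentSymbol σ ξ * ((2 * Real.pi * ‖ξ‖) ^ σ : ℝ) = c := by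
  obtain ⟨e, he⟩ := exists_norm_eq E zero_le_one
  have hpi : 0 < 2 * Real.pi := by positivity
  refine ⟨tentSymbol σ e * ((2 * Real.pi) ^ σ : ℝ), mul_ne_zero (tentSymbol_ne_zero hσ he) ?_,
    fun ξ hξ => ?_⟩
  · exact_mod_cast (Real.rpow_pos_of_pos hpi σ).ne'
  · rw [eq_rpow_norm_smul_of_radial (tentSymbol_map σ)
      (fun c hc ξ => tentSymbol_smul σ hc ξ) he hξ, Real.mul_rpow hpi.le (norm_nonneg _),
      Complex.real_smul, Real.rpow_neg (norm_nonneg _)]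
    have : ((‖ξ‖ ^ σ : ℝ) : ℂ) ≠ 0 := by
      exact_mod_cast (Real.rpow_pos_of_pos (norm_pos_iff.2 hξ) σ).ne'
    push_cast
    field_simp

end Symbols

/-! ### Subordination and the Fourier transform of the Poisson kernel. -/

section Poisson

lemma image_mul_sub_div_Ioi {a b : ℝ} (ha : 0 < a) (hb : 0 < b) :
    (fun r => a * r - b / r) '' Ioi 0 = univ := by
  refine eq_univ_of_forall fun w => ?_
  have h1 : w ^ 2 < w ^ 2 + 4 * a * b := by nlinarith [mul_pos ha hb]
  have hs := Real.sq_sqrt ((sq_nonneg w).trans h1.le)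
  have h2 : |w| < √(w ^ 2 + 4 * a * b) := by
    rw [← Real.sqrt_sq_eq_abs]
    exact Real.sqrt_lt_sqrt (sq_nonneg w) h1
  set q := √(w ^ 2 + 4 * a * b)
  -- The preimage of `w` is the positive root of `a r² - w r - b = 0`.
  have hr : 0 < (w + q) / (2 * a) := div_pos (by linarith [neg_abs_le w]) (by positivity)
  refine ⟨(w + q) / (2 * a), hr, ?_⟩
  have h3 : 0 < w + q := by linarith [neg_abs_le w]
  simp only
  field_simp
  nlinarith

lemma injOn_mul_sub_div_Ioi {a b : ℝ} (ha : 0 < a) (hb : 0 < b) :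
    InjOn (fun r => a * r - b / r) (Ioi 0) := by
  intro r (hr : 0 < r) s (hs : 0 < s) h
  simp only at h
  have h1 : (r - s) * (a + b / (r * s)) = 0 := by
    have : (r - s) * (a + b / (r * s)) = (a * r - b / r) - (a * s - b / s) := by
      field_simp
      ring
    rw [this, h, sub_self]
  rcases mul_eq_zero.1 h1 with h2 | h2
  · linarith
  · have : 0 < a + b / (r * s) := by positivity
    linarith

lemma hasDerivAt_mul_sub_div (a b : ℝ) {r : ℝ} (hr : 0 < r) :
    HasDerivAt (fun r => a * r - b / r) (a + b / r ^ 2) r := by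
  have h := ((hasDerivAt_id r).const_mul a).sub ((hasDerivAt_inv hr.ne').const_mul b)
  convert! h using 1
  ring

/-- The substitution `w = a r - b / r` turns the Gaussian integral into one with density `a + b /
r²`. The inversion `r ↦ b / (a r)` changes the sign of `w` and exchanges the two parts of that
density, so each contributes half of `√π`. -/
lemma integral_exp_neg_sq_mul_sub_div {a b : ℝ} (ha : 0 < a) (hb : 0 < b) :
    ∫ r in Ioi (0 : ℝ), Real.exp (-(a * r - b / r) ^ 2) = √Real.pi / (2 * a) := by
  set φ : ℝ → ℝ := fun r => a * r - b / r with hφ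
  have hd : ∀ r ∈ Ioi (0 : ℝ), HasDerivWithinAt φ (a + b / r ^ 2) (Ioi 0) r :=
    fun r hr => (hasDerivAt_mul_sub_div a b hr).hasDerivWithinAt
  have hcont : ContinuousOn φ (Ioi 0) := fun r hr => (hd r hr).continuousWithinAt
  have hgauss : ∫ w : ℝ, Real.exp (-w ^ 2) = √Real.pi := by
    simpa using integral_gaussian 1
  have hgi : Integrable fun w : ℝ => Real.exp (-w ^ 2) := by
    simpa using integrable_exp_neg_mul_sq one_pos
  have habs : ∀ r : ℝ, |a + b / r ^ 2| = a + b / r ^ 2 := fun r => abs_of_nonneg (by positivity)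
  have hint : IntegrableOn (fun r => (a + b / r ^ 2) * Real.exp (-φ r ^ 2)) (Ioi 0) := by
    have := (integrableOn_image_iff_integrableOn_abs_deriv_smul measurableSet_Ioi hd
      (injOn_mul_sub_div_Ioi ha hb) fun w => Real.exp (-w ^ 2)).1
      (by rw [image_mul_sub_div_Ioi ha hb]; exact hgi.integrableOn)
    simpa only [habs, smul_eq_mul] using this
  have heq : ∫ r in Ioi (0 : ℝ), (a + b / r ^ 2) * Real.exp (-φ r ^ 2) = √Real.pi := by
    have := integral_image_eq_integral_abs_deriv_smul measurableSet_Ioi hd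
      (injOn_mul_sub_div_Ioi ha hb) fun w => Real.exp (-w ^ 2)
    rw [image_mul_sub_div_Ioi ha hb, setIntegral_univ, hgauss] at this
    simpa only [habs, smul_eq_mul] using this.symm
  have hm : AEStronglyMeasurable (fun r => Real.exp (-φ r ^ 2)) (volume.restrict (Ioi 0)) :=
    ContinuousOn.aestronglyMeasurable (by fun_prop) measurableSet_Ioi
  have hi1 : IntegrableOn (fun r => Real.exp (-φ r ^ 2)) (Ioi 0) := by
    refine Integrable.mono' (hint.const_mul a⁻¹) hm (ae_of_all _ fun r => ?_)
    rw [Real.norm_of_nonneg (Real.exp_nonneg _), ← mul_assoc]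
    refine le_mul_of_one_le_left (Real.exp_nonneg _) ?_
    rw [mul_add, inv_mul_cancel₀ ha.ne']
    have : 0 ≤ a⁻¹ * (b / r ^ 2) := by positivity
    linarith
  have hi2 : IntegrableOn (fun r => b / r ^ 2 * Real.exp (-φ r ^ 2)) (Ioi 0) := by
    refine (hint.sub (hi1.const_mul a)).congr (ae_of_all _ fun r => ?_)
    simp only [Pi.sub_apply]
    ring
  have hψ : ∀ r ∈ Ioi (0 : ℝ), HasDerivWithinAt (fun r => b / a * r⁻¹) (-(b / a * (r ^ 2)⁻¹))
      (Ioi 0) r := fun r hr => by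
    have := ((hasDerivAt_inv (ne_of_gt hr)).const_mul (b / a)).hasDerivWithinAt (s := Ioi 0)
    simpa using this
  have himg : (fun r => b / a * r⁻¹) '' Ioi 0 = Ioi 0 := by
    refine Subset.antisymm ?_ fun r (hr : 0 < r) => ⟨b / a * r⁻¹, ?_, ?_⟩
    · rintro _ ⟨r, hr : 0 < r, rfl⟩
      exact mul_pos (div_pos hb ha) (inv_pos.2 hr)
    · exact mul_pos (div_pos hb ha) (inv_pos.2 hr)
    · simp only
      field_simp
  have hinj : InjOn (fun r => b / a * r⁻¹) (Ioi 0) := fun r hr s hs h =>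
    inv_injective (mul_left_cancel₀ (div_pos hb ha).ne' h)
  have hsym : ∫ r in Ioi (0 : ℝ), Real.exp (-φ r ^ 2) =
      a⁻¹ * ∫ r in Ioi (0 : ℝ), b / r ^ 2 * Real.exp (-φ r ^ 2) := by
    have := integral_image_eq_integral_abs_deriv_smul measurableSet_Ioi hψ hinj
      fun w => Real.exp (-φ w ^ 2)
    rw [himg] at this
    rw [this, ← integral_const_mul]
    refine setIntegral_congr_fun measurableSet_Ioi fun r (hr : 0 < r) => ?_
    simp only [hφ, smul_eq_mul]
    rw [abs_neg, abs_of_nonneg (by positivity),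
      show a * (b / a * r⁻¹) - b / (b / a * r⁻¹) = -(a * r - b / r) by field_simp; ring, neg_sq]
    ring
  have hsum : √Real.pi = a * (∫ r in Ioi (0 : ℝ), Real.exp (-φ r ^ 2)) +
      ∫ r in Ioi (0 : ℝ), b / r ^ 2 * Real.exp (-φ r ^ 2) := by
    rw [← heq, ← integral_const_mul, ← integral_add (hi1.const_mul a) hi2]
    congr 1
    funext r
    ring
  have h2 : ∫ r in Ioi (0 : ℝ), b / r ^ 2 * Real.exp (-φ r ^ 2) =
      a * ∫ r in Ioi (0 : ℝ), Real.exp (-φ r ^ 2) := by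
    rw [hsym, ← mul_assoc, mul_inv_cancel₀ ha.ne', one_mul]
  rw [h2] at hsum
  rw [hsum, eq_div_iff (by positivity)]
  ring

/-- The subordination integral. -/
lemma integral_exp_neg_sq_sub_sq_div {a b : ℝ} (ha : 0 < a) (hb : 0 ≤ b) :
    ∫ r in Ioi (0 : ℝ), Real.exp (-(a * r) ^ 2 - (b / r) ^ 2) =
      √Real.pi / (2 * a) * Real.exp (-(2 * a * b)) := by
  rcases hb.eq_or_lt with rfl | hb
  · have := integral_gaussian_Ioi (a ^ 2)
    rw [Real.sqrt_div Real.pi_pos.le, Real.sqrt_sq ha.le] at this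
    simp only [zero_div, mul_zero, neg_zero, Real.exp_zero, mul_one]
    convert! this using 1
    · congr 1
      funext r
      ring_nf
    · field_simp
  · rw [← integral_exp_neg_sq_mul_sub_div ha hb, ← integral_mul_const]
    refine setIntegral_congr_fun measurableSet_Ioi fun r (hr : 0 < r) => ?_
    rw [← Real.exp_add]
    congr 1
    field_simp
    ring

variable {n : ℕ}

/-- The Gamma integral writes the kernel as a mixture of Gaussians, whose Fourier transforms are
explicit; `integral_exp_neg_sq_sub_sq_div` then recombines them. -/
lemma halfSpacePoissonKernel_eq_integral {t : ℝ} (ht : 0 < t) (y : EuclideanSpace ℝ (Fin n)) :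
    halfSpacePoissonKernel y t = 2 * t / Real.pi ^ (((n : ℝ) + 1) / 2) *
      ∫ r in Ioi (0 : ℝ), r ^ n * Real.exp (-(t ^ 2 + ‖y‖ ^ 2) * r ^ 2) := by
  have hb : 0 < t ^ 2 + ‖y‖ ^ 2 := by positivity
  have h := integral_rpow_mul_exp_neg_mul_rpow (p := 2) (q := n) (b := t ^ 2 + ‖y‖ ^ 2) two_pos
    (by linarith [(Nat.cast_nonneg n : (0 : ℝ) ≤ n)]) hb
  simp only [Real.rpow_natCast, Real.rpow_two] at h
  rw [h, halfSpacePoissonKernel, neg_div, Real.rpow_neg hb.le]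
  field_simp

lemma pow_mul_pi_div_sq_rpow {r : ℝ} (hr : 0 < r) :
    r ^ n * (Real.pi / r ^ 2) ^ ((n : ℝ) / 2) = Real.pi ^ ((n : ℝ) / 2) := by
  rw [Real.div_rpow Real.pi_pos.le (by positivity), ← Real.rpow_natCast r 2, ← Real.rpow_mul hr.le,
    ← Real.rpow_natCast r n, show ((2 : ℕ) : ℝ) * (n / 2) = n by push_cast; ring]
  have := Real.rpow_pos_of_pos hr n
  field_simp

lemma integrable_gaussian_mixture {t : ℝ} (ht : 0 < t) :
    Integrable (fun p : EuclideanSpace ℝ (Fin n) × ℝ =>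
      p.2 ^ n * Real.exp (-(t ^ 2 + ‖p.1‖ ^ 2) * p.2 ^ 2))
      (volume.prod (volume.restrict (Ioi 0))) := by
  rw [integrable_prod_iff' (Continuous.aestronglyMeasurable (by fun_prop))]
  have hfac : ∀ (r : ℝ) (y : EuclideanSpace ℝ (Fin n)),
      r ^ n * Real.exp (-(t ^ 2 + ‖y‖ ^ 2) * r ^ 2) =
        r ^ n * Real.exp (-t ^ 2 * r ^ 2) * Real.exp (-r ^ 2 * ‖y‖ ^ 2) := by
    intro r y
    rw [mul_assoc, ← Real.exp_add]
    ring_nf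
  constructor
  · refine (ae_restrict_iff' measurableSet_Ioi).2 (ae_of_all _ fun r (hr : 0 < r) => ?_)
    simp only [hfac]
    refine Integrable.const_mul ?_ _
    have h := (GaussianFourier.integrable_cexp_neg_mul_sq_norm_add (b := ((r ^ 2 : ℝ) : ℂ))
      (by rw [Complex.ofReal_re]; positivity) 0 (0 : EuclideanSpace ℝ (Fin n))).norm
    refine h.congr (ae_of_all _ fun y => ?_)
    simp only [Complex.norm_exp]
    congr 1
    norm_cast
    simp
  · have h2 : IntegrableOn (fun r : ℝ => Real.pi ^ ((n : ℝ) / 2) * Real.exp (-t ^ 2 * r ^ 2))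
        (Ioi 0) := ((integrable_exp_neg_mul_sq (by positivity)).const_mul _).integrableOn
    refine h2.congr ((ae_restrict_iff' measurableSet_Ioi).2 (ae_of_all _ fun r (hr : 0 < r) => ?_))
    have hn : ∀ y : EuclideanSpace ℝ (Fin n),
        ‖r ^ n * Real.exp (-(t ^ 2 + ‖y‖ ^ 2) * r ^ 2)‖ =
        r ^ n * Real.exp (-t ^ 2 * r ^ 2) * Real.exp (-r ^ 2 * ‖y‖ ^ 2) := fun y => by
      rw [Real.norm_of_nonneg (by positivity), hfac]
    simp only [hn]
    rw [integral_const_mul, GaussianFourier.integral_rexp_neg_mul_sq_norm (by positivity),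
      finrank_euclideanSpace_fin, mul_right_comm, pow_mul_pi_div_sq_rpow hr]

lemma integrable_halfSpacePoissonKernel {t : ℝ} (ht : 0 < t) :
    Integrable fun y : EuclideanSpace ℝ (Fin n) => halfSpacePoissonKernel y t := by
  simp_rw [halfSpacePoissonKernel_eq_integral ht]
  exact (integrable_gaussian_mixture ht).integral_prod_left.const_mul _

/-- The Fourier transform of the Poisson kernel. -/
lemma integral_halfSpacePoissonKernel_mul_cexp {t : ℝ} (ht : 0 < t)
    (ξ : EuclideanSpace ℝ (Fin n)) :
    ∫ y : EuclideanSpace ℝ (Fin n), (halfSpacePoissonKernel y t : ℂ) *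
      Complex.exp (-2 * Real.pi * Complex.I * inner ℝ ξ y) =
      (Real.exp (-(2 * Real.pi * ‖ξ‖ * t)) : ℝ) := by
  set K : ℝ := 2 * t / Real.pi ^ (((n : ℝ) + 1) / 2) with hK
  have hnorm : ∀ y : EuclideanSpace ℝ (Fin n),
      ‖Complex.exp (-2 * Real.pi * Complex.I * inner ℝ ξ y)‖ = 1 := by
    intro y
    rw [show -2 * Real.pi * Complex.I * (inner ℝ ξ y : ℂ) = ((-2 * Real.pi * inner ℝ ξ y : ℝ) : ℂ) *
      Complex.I by push_cast; ring, Complex.norm_exp_ofReal_mul_I]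
  have hint : Integrable (fun p : EuclideanSpace ℝ (Fin n) × ℝ =>
      ((p.2 ^ n * Real.exp (-(t ^ 2 + ‖p.1‖ ^ 2) * p.2 ^ 2) : ℝ) : ℂ) *
      Complex.exp (-2 * Real.pi * Complex.I * inner ℝ ξ p.1))
      (volume.prod (volume.restrict (Ioi 0))) := by
    refine (integrable_gaussian_mixture ht).mono (Continuous.aestronglyMeasurable (by fun_prop))
      (ae_of_all _ fun p => ?_)
    rw [norm_mul, hnorm, mul_one, Complex.norm_real]
  have hinner : ∀ r : ℝ, 0 < r → ∫ y : EuclideanSpace ℝ (Fin n),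
      ((r ^ n * Real.exp (-(t ^ 2 + ‖y‖ ^ 2) * r ^ 2) : ℝ) : ℂ) *
      Complex.exp (-2 * Real.pi * Complex.I * inner ℝ ξ y) =
      ((Real.pi ^ ((n : ℝ) / 2) * Real.exp (-(t * r) ^ 2 - (Real.pi * ‖ξ‖ / r) ^ 2) : ℝ) : ℂ) := by
    intro r hr
    have h := GaussianFourier.integral_cexp_neg_mul_sq_norm_add (b := ((r ^ 2 : ℝ) : ℂ))
      (by rw [Complex.ofReal_re]; positivity) (-2 * Real.pi * Complex.I) ξ
    have h1 : (Real.pi / ((r ^ 2 : ℝ) : ℂ)) ^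
        ((Module.finrank ℝ (EuclideanSpace ℝ (Fin n)) : ℂ) / 2) =
        (((Real.pi / r ^ 2) ^ ((n : ℝ) / 2) : ℝ) : ℂ) := by
      rw [Complex.ofReal_cpow (by positivity), finrank_euclideanSpace_fin]
      push_cast
      rfl
    have h2 : Complex.exp ((-2 * Real.pi * Complex.I) ^ 2 * ‖ξ‖ ^ 2 / (4 * ((r ^ 2 : ℝ) : ℂ))) =
        (Real.exp (-(Real.pi * ‖ξ‖ / r) ^ 2) : ℝ) := by
      push_cast
      congr 1
      have : (r : ℂ) ≠ 0 := by exact_mod_cast hr.ne'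
      field_simp
      rw [Complex.I_sq]
      ring
    rw [h1, h2] at h
    calc _ = ∫ y : EuclideanSpace ℝ (Fin n), ((r ^ n * Real.exp (-(t * r) ^ 2) : ℝ) : ℂ) *
          Complex.exp (-((r ^ 2 : ℝ) : ℂ) * ‖y‖ ^ 2 + -2 * Real.pi * Complex.I * inner ℝ ξ y) := by
          congr 1
          funext y
          push_cast
          rw [mul_assoc, mul_assoc ((r : ℂ) ^ n), ← Complex.exp_add, ← Complex.exp_add]
          congr 2
          ring
      _ = _ := by
          rw [integral_const_mul, h, ← pow_mul_pi_div_sq_rpow hr, sub_eq_add_neg, Real.exp_add]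
          push_cast
          ring
  calc _ = ∫ y : EuclideanSpace ℝ (Fin n), (K : ℂ) * ∫ r in Ioi (0 : ℝ),
        ((r ^ n * Real.exp (-(t ^ 2 + ‖y‖ ^ 2) * r ^ 2) : ℝ) : ℂ) *
        Complex.exp (-2 * Real.pi * Complex.I * inner ℝ ξ y) := by
        congr 1
        funext y
        rw [halfSpacePoissonKernel_eq_integral ht, integral_mul_const, integral_complex_ofReal, ← hK,
          Complex.ofReal_mul, mul_assoc]
    _ = K * ∫ r in Ioi (0 : ℝ), ((Real.pi ^ ((n : ℝ) / 2) *
          Real.exp (-(t * r) ^ 2 - (Real.pi * ‖ξ‖ / r) ^ 2) : ℝ) : ℂ) := by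
        rw [integral_const_mul, integral_integral_swap hint]
        congr 1
        exact setIntegral_congr_fun measurableSet_Ioi fun r hr => hinner r hr
    _ = _ := by
        rw [integral_complex_ofReal, integral_const_mul,
          integral_exp_neg_sq_sub_sq_div ht (by positivity), ← Complex.ofReal_mul]
        congr 1
        rw [hK, add_div, Real.rpow_add Real.pi_pos, ← Real.sqrt_eq_rpow,
          show 2 * Real.pi * ‖ξ‖ * t = 2 * t * (Real.pi * ‖ξ‖) by ring]
        have := Real.sqrt_pos.2 Real.pi_pos
        field_simp

end Poisson

/-! ### Superpositions of plane waves and the normal derivative of the extension. -/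

section PlaneWave

lemma mul_exp_neg_mul_le {t r : ℝ} (ht : 0 < t) : r * Real.exp (-(r * t)) ≤ 1 / t := by
  rw [le_div_iff₀ ht, Real.exp_neg, mul_right_comm, ← div_eq_mul_inv, div_le_one (Real.exp_pos _)]
  linarith [Real.add_one_le_exp (r * t)]

lemma norm_normalDeriv_symbol_le {E : Type*} [NormedAddCommGroup E] {t : ℝ} (ht : 0 < t) (ξ : E) (z : ℂ) :
    ‖((-(2 * Real.pi * ‖ξ‖) * Real.exp (-(2 * Real.pi * ‖ξ‖ * t)) : ℝ) : ℂ) * z‖ ≤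
      1 / t * ‖z‖ := by
  rw [norm_mul, Complex.norm_real, neg_mul, norm_neg, Real.norm_of_nonneg (by positivity)]
  gcongr
  exact mul_exp_neg_mul_le ht

variable {E : Type*} [NormedAddCommGroup E] [InnerProductSpace ℝ E]

/-- The character `exp (2 π i ⟪ξ, x⟫)`. -/
noncomputable def planeWave (ξ x : E) : ℂ :=
  Complex.exp (((2 * Real.pi * inner ℝ ξ x : ℝ) : ℂ) * Complex.I)

lemma norm_planeWave (ξ x : E) : ‖planeWave ξ x‖ = 1 := Complex.norm_exp_ofReal_mul_I _

lemma planeWave_add (ξ x y : E) : planeWave ξ (x + y) = planeWave ξ x * planeWave ξ y := by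
  simp only [planeWave, ← Complex.exp_add, inner_add_right]
  push_cast
  ring_nf

lemma continuous_planeWave : Continuous fun p : E × E => planeWave p.1 p.2 := by
  unfold planeWave
  fun_prop

@[fun_prop]
lemma Continuous.planeWave {X : Type*} [TopologicalSpace X] {f g : X → E} (hf : Continuous f)
    (hg : Continuous g) : Continuous fun x => planeWave (f x) (g x) :=
  continuous_planeWave.comp (hf.prodMk hg)

variable [FiniteDimensional ℝ E] [MeasurableSpace E] [BorelSpace E]

lemma fourierInv_eq_integral_planeWave (m : E → ℂ) (x : E) :
    𝓕⁻ m x = ∫ ξ, planeWave ξ x * m ξ := by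
  rw [Real.fourierInv_eq']
  rfl

lemma integral_mul_planeWave_neg (f : E → ℂ) (ξ : E) :
    ∫ y, f y * planeWave ξ (-y) = 𝓕 f ξ := by
  rw [Real.fourier_eq']
  congr 1
  funext y
  rw [planeWave, inner_neg_right, real_inner_comm, smul_eq_mul, mul_comm]
  push_cast
  ring_nf

lemma integrable_planeWave_mul {m : E → ℂ} (hm : Integrable m) (x : E) :
    Integrable fun ξ => planeWave ξ x * m ξ :=
  hm.bdd_mul (c := 1) (Continuous.aestronglyMeasurable (by fun_prop))
    (ae_of_all _ fun ξ => (norm_planeWave ξ x).le)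

/-- Superposing translates of a superposition of plane waves. -/
lemma integral_mul_integral_planeWave {f m : E → ℂ} (hf : Integrable f) (hm : Integrable m) (x : E) :
    ∫ y, f y * ∫ ξ, planeWave ξ (x - y) * m ξ = ∫ ξ, planeWave ξ x * (𝓕 f ξ * m ξ) := by
  have hint : Integrable (Function.uncurry fun y ξ : E => f y * (planeWave ξ (x - y) * m ξ))
      (volume.prod volume) := by
    refine ((hf.mul_prod hm).bdd_mul (c := 1) (f := fun p : E × E => planeWave p.2 (x - p.1))
      (Continuous.aestronglyMeasurable (by fun_prop))
      (ae_of_all _ fun p => (norm_planeWave _ _).le)).congr (ae_of_all _ fun p => ?_)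
    simp only [Function.uncurry]
    ring
  calc _ = ∫ y, ∫ ξ, f y * (planeWave ξ (x - y) * m ξ) := by simp_rw [integral_const_mul]
    _ = ∫ ξ, ∫ y, f y * (planeWave ξ (x - y) * m ξ) := integral_integral_swap hint
    _ = _ := by
      congr 1
      funext ξ
      rw [← integral_mul_planeWave_neg, ← integral_mul_const, ← integral_const_mul]
      congr 1
      funext y
      rw [sub_eq_add_neg, planeWave_add]
      ring

/-- The normal derivative of the harmonic extension of the inverse Fourier transform of `m`. -/
noncomputable def normalDeriv (m : E → ℂ) (x : E) (t : ℝ) : ℂ :=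
  ∫ ξ, planeWave ξ x *
    (((-(2 * Real.pi * ‖ξ‖) * Real.exp (-(2 * Real.pi * ‖ξ‖ * t)) : ℝ) : ℂ) * m ξ)

lemma integrable_normalDeriv_symbol {m : E → ℂ} (hm : Integrable m) {t : ℝ} (ht : 0 < t) :
    Integrable fun ξ =>
      ((-(2 * Real.pi * ‖ξ‖) * Real.exp (-(2 * Real.pi * ‖ξ‖ * t)) : ℝ) : ℂ) * m ξ := by
  refine (hm.norm.const_mul (1 / t)).mono' ?_
    (ae_of_all _ fun ξ => norm_normalDeriv_symbol_le ht ξ (m ξ))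
  exact (Continuous.aestronglyMeasurable (by fun_prop)).mul hm.aestronglyMeasurable

lemma hasDerivAt_poissonExtension {m : E → ℂ} (hm : Integrable m) (x : E) {t : ℝ} (ht : 0 < t) :
    HasDerivAt (fun τ : ℝ => ∫ ξ, planeWave ξ x *
      (((Real.exp (-(2 * Real.pi * ‖ξ‖ * τ)) : ℝ) : ℂ) * m ξ)) (normalDeriv m x t) t := by
  have hmeas : ∀ τ : ℝ, AEStronglyMeasurable (fun ξ => planeWave ξ x *
      (((Real.exp (-(2 * Real.pi * ‖ξ‖ * τ)) : ℝ) : ℂ) * m ξ)) := fun τ =>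
    (Continuous.aestronglyMeasurable (by fun_prop)).mul
      ((Continuous.aestronglyMeasurable (by fun_prop)).mul hm.aestronglyMeasurable)
  -- For `τ > t / 2` the differentiated symbol is at most `1 / (t / 2)`, uniformly in `ξ`, so a
  -- multiple of `‖m ξ‖` dominates.
  refine (hasDerivAt_integral_of_dominated_loc_of_deriv_le (s := Ioi (t / 2))
    (F' := fun τ ξ => planeWave ξ x * (((-(2 * Real.pi * ‖ξ‖) *
      Real.exp (-(2 * Real.pi * ‖ξ‖ * τ)) : ℝ) : ℂ) * m ξ))
    (bound := fun ξ => 1 / (t / 2) * ‖m ξ‖) (Ioi_mem_nhds (by linarith))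
    (.of_forall hmeas) ?_ ?_ ?_ (hm.norm.const_mul _) ?_).2
  · refine hm.norm.mono' (hmeas t) (ae_of_all _ fun ξ => ?_)
    rw [norm_mul, norm_planeWave, one_mul, norm_mul, Complex.norm_real,
      Real.norm_of_nonneg (Real.exp_nonneg _)]
    refine mul_le_of_le_one_left (norm_nonneg _) (Real.exp_le_one_iff.2 ?_)
    have : 0 ≤ 2 * Real.pi * ‖ξ‖ * t := by positivity
    linarith
  · exact (Continuous.aestronglyMeasurable (by fun_prop)).mul
      (integrable_normalDeriv_symbol hm ht).aestronglyMeasurable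
  · refine ae_of_all _ fun ξ τ (hτ : t / 2 < τ) => ?_
    rw [norm_mul, norm_planeWave, one_mul]
    refine (norm_normalDeriv_symbol_le ((half_pos ht).trans hτ) ξ (m ξ)).trans ?_
    gcongr
  · refine ae_of_all _ fun ξ τ _ => HasDerivAt.const_mul _ (HasDerivAt.mul_const ?_ _)
    refine HasDerivAt.ofReal_comp ?_
    have h := (((hasDerivAt_id τ).const_mul (2 * Real.pi * ‖ξ‖)).neg).exp
    convert! h using 1
    simp
    ring

lemma measurable_normalDeriv {m : E → ℂ} (hm : Measurable m) :
    Measurable fun p : ℝ × E => normalDeriv m p.2 p.1 := by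
  refine StronglyMeasurable.measurable ?_
  refine StronglyMeasurable.integral_prod_right' (f := fun q : (ℝ × E) × E => planeWave q.2 q.1.2 *
    (((-(2 * Real.pi * ‖q.2‖) * Real.exp (-(2 * Real.pi * ‖q.2‖ * q.1.1)) : ℝ) : ℂ) * m q.2)) ?_
  refine Measurable.stronglyMeasurable ?_
  refine Measurable.mul (Continuous.measurable (by fun_prop)) ?_
  exact Measurable.mul (Continuous.measurable (by fun_prop)) (hm.comp measurable_snd)

lemma norm_normalDeriv_le {m : E → ℂ} (hm : Integrable m) (x : E) {t : ℝ} (ht : 0 < t) :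
    ‖normalDeriv m x t‖ ≤ 1 / t * ∫ ξ, ‖m ξ‖ := by
  rw [← integral_const_mul]
  refine norm_integral_le_of_norm_le (hm.norm.const_mul _) (ae_of_all _ fun ξ => ?_)
  rw [norm_mul, norm_planeWave, one_mul]
  exact norm_normalDeriv_symbol_le ht ξ (m ξ)

/-- The dilated bump `t ^ (-d) * tent (y / t)`. -/
noncomputable def dilatedTent (t : ℝ) (y : E) : ℝ :=
  t ^ (-Module.finrank ℝ E : ℝ) * tent (t⁻¹ • y)

lemma integrable_dilatedTent {t : ℝ} (ht : 0 < t) : Integrable (dilatedTent t : E → ℝ) :=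
  ((integrable_comp_smul_iff volume (tent : E → ℝ) (inv_ne_zero ht.ne')).2
    integrable_tent).const_mul _

lemma fourier_dilatedTent {t : ℝ} (ht : 0 < t) (ξ : E) :
    𝓕 (fun y : E => (dilatedTent t y : ℂ)) ξ = 𝓕 (fun y : E => (tent y : ℂ)) (t • ξ) := by
  rw [← integral_mul_planeWave_neg, ← integral_mul_planeWave_neg]
  have h := Measure.integral_comp_inv_smul_of_nonneg (volume : Measure E)
    (fun y => (tent y : ℂ) * planeWave (t • ξ) (-y)) ht.le
  have h2 : ∫ y : E, (dilatedTent t y : ℂ) * planeWave ξ (-y) =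
      ((t ^ (-Module.finrank ℝ E : ℝ) : ℝ) : ℂ) *
        ∫ y : E, (tent (t⁻¹ • y) : ℂ) * planeWave (t • ξ) (-(t⁻¹ • y)) := by
    rw [← integral_const_mul]
    congr 1
    funext y
    have h3 : planeWave (t • ξ) (-(t⁻¹ • y)) = planeWave ξ (-y) := by
      simp only [planeWave, ← smul_neg, real_inner_smul_left, real_inner_smul_right]
      rw [inv_mul_cancel_left₀ ht.ne']
    rw [h3, dilatedTent]
    push_cast
    ring
  rw [h2, h, Complex.real_smul, ← mul_assoc, ← Complex.ofReal_mul, Real.rpow_neg ht.le,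
    Real.rpow_natCast, inv_mul_cancel₀ (by positivity), Complex.ofReal_one, one_mul]

lemma integral_dilatedTent_mul_normalDeriv {m : E → ℂ} (hm : Integrable m) (x : E) {t : ℝ}
    (ht : 0 < t) :
    ∫ y : E, (dilatedTent t y : ℂ) * normalDeriv m (x - y) t =
      ∫ ξ, planeWave ξ x * (𝓕 (fun y : E => (tent y : ℂ)) (t • ξ) *
        (((-(2 * Real.pi * ‖ξ‖) * Real.exp (-(2 * Real.pi * ‖ξ‖ * t)) : ℝ) : ℂ) * m ξ)) := by
  have h := integral_mul_integral_planeWave (integrable_dilatedTent (E := E) ht).ofReal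
    (integrable_normalDeriv_symbol hm ht) x
  simp only [RCLike.ofReal_eq_complex_ofReal] at h
  simp_rw [← fourier_dilatedTent ht]
  exact h

end PlaneWave

/-! ### The Poisson integral on the Fourier side. -/

section HarmonicExtension

variable {n : ℕ}

local notation "𝔼" => EuclideanSpace ℝ (Fin n)

lemma harmonicExtension_fourierInv {m : 𝔼 → ℂ} (hm : Integrable m) (x : 𝔼) {t : ℝ} (ht : 0 < t) :
    harmonicExtension (𝓕⁻ m) x t =
      ∫ ξ, planeWave ξ x * (((Real.exp (-(2 * Real.pi * ‖ξ‖ * t)) : ℝ) : ℂ) * m ξ) := by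
  have h := integral_mul_integral_planeWave
    (integrable_halfSpacePoissonKernel (n := n) ht).ofReal hm x
  have hP : ∀ ξ : 𝔼, 𝓕 (fun y : 𝔼 => (halfSpacePoissonKernel y t : ℂ)) ξ =
      (Real.exp (-(2 * Real.pi * ‖ξ‖ * t)) : ℝ) := by
    intro ξ
    rw [← integral_mul_planeWave_neg, ← integral_halfSpacePoissonKernel_mul_cexp ht]
    congr 1
    funext y
    rw [planeWave, inner_neg_right]
    push_cast
    ring_nf
  simp_rw [← hP]
  unfold harmonicExtension
  simp_rw [fourierInv_eq_integral_planeWave]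
  exact h

lemma deriv_harmonicExtension_fourierInv {m : 𝔼 → ℂ} (hm : Integrable m) (x : 𝔼) {t : ℝ}
    (ht : 0 < t) :
    deriv (fun τ : ℝ => harmonicExtension (𝓕⁻ m) x τ) t = normalDeriv m x t := by
  refine ((hasDerivAt_poissonExtension hm x ht).congr_of_eventuallyEq ?_).deriv
  filter_upwards [Ioi_mem_nhds ht] with τ hτ
  exact harmonicExtension_fourierInv hm x hτ

/-- The argument uses only `∂_t U`; the tangential part of the gradient is discarded. -/
lemma sq_norm_normalDeriv_le_gradSq {m : 𝔼 → ℂ} (hm : Integrable m) (x : 𝔼) {t : ℝ} (ht : 0 < t) :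
    ‖normalDeriv m x t‖ ^ 2 ≤ gradSq (𝓕⁻ m) x t := by
  rw [gradSq, deriv_harmonicExtension_fourierInv hm x ht]
  exact le_add_of_nonneg_right (by positivity)

end HarmonicExtension

/-! ### The reproducing formula and pointwise control of first differences. -/

section Reproducing

variable {E : Type*} [NormedAddCommGroup E] [InnerProductSpace ℝ E] [FiniteDimensional ℝ E]
  [MeasurableSpace E] [BorelSpace E]

/-- The multiplier `|ξ| ^ s` applied to the Fourier transform of a Schwartz function. -/
noncomputable def multiplier (s : ℝ) (u : 𝓢(E, ℂ)) (ξ : E) : ℂ :=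
  (((2 * Real.pi * ‖ξ‖) ^ s : ℝ) : ℂ) * 𝓕 (u : E → ℂ) ξ

lemma continuous_fourier_schwartz (u : 𝓢(E, ℂ)) : Continuous (𝓕 (u : E → ℂ)) := by
  rw [← SchwartzMap.fourier_coe]
  exact (𝓕 u).continuous

lemma integrable_fourier_schwartz (u : 𝓢(E, ℂ)) : Integrable (𝓕 (u : E → ℂ)) := by
  rw [← SchwartzMap.fourier_coe]
  exact (𝓕 u).integrable

lemma eq_integral_planeWave (u : 𝓢(E, ℂ)) (x : E) :
    u x = ∫ ξ, planeWave ξ x * 𝓕 (u : E → ℂ) ξ := by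
  rw [← fourierInv_eq_integral_planeWave,
    u.continuous.fourierInv_fourier_eq u.integrable (integrable_fourier_schwartz u)]

lemma continuous_multiplier {s : ℝ} (hs : 0 ≤ s) (u : 𝓢(E, ℂ)) : Continuous (multiplier s u) := by
  have := continuous_fourier_schwartz u
  unfold multiplier
  fun_prop (disch := assumption)

lemma integrable_multiplier {s : ℝ} (hs : s ∈ Ioo (0 : ℝ) 2) (u : 𝓢(E, ℂ)) :
    Integrable (multiplier s u) := by
  have h0 := (integrable_fourier_schwartz u).norm
  have h2 : Integrable fun ξ => ‖ξ‖ ^ 2 * ‖𝓕 (u : E → ℂ) ξ‖ := by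
    rw [← SchwartzMap.fourier_coe]
    exact (𝓕 u).integrable_pow_mul volume 2
  refine (h0.add (h2.const_mul ((2 * Real.pi) ^ 2))).mono'
    (continuous_multiplier hs.1.le u).aestronglyMeasurable (ae_of_all _ fun ξ => ?_)
  rw [multiplier, norm_mul, Complex.norm_real, Real.norm_of_nonneg (by positivity)]
  have hle : (2 * Real.pi * ‖ξ‖) ^ s ≤ 1 + (2 * Real.pi * ‖ξ‖) ^ 2 := by
    set r := 2 * Real.pi * ‖ξ‖
    have hr : 0 ≤ r := by positivity
    rcases le_total r 1 with h | h
    · exact (Real.rpow_le_one hr h hs.1.le).trans (by nlinarith)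
    · have := Real.rpow_le_rpow_of_exponent_le h hs.2.le
      rw [Real.rpow_two] at this
      linarith
  calc _ ≤ (1 + (2 * Real.pi * ‖ξ‖) ^ 2) * ‖𝓕 (u : E → ℂ) ξ‖ := by gcongr
    _ = _ := by simp only [Pi.add_apply]; ring

/-- Absolute convergence of the reproducing integral on the Fourier side. -/
lemma integrable_reproducing {σ : ℝ} (hσ : σ ∈ Ioo (0 : ℝ) 1) (u : 𝓢(E, ℂ)) (x : E) :
    Integrable (fun p : E × ℝ => ((p.2 ^ σ : ℝ) : ℂ) * (planeWave p.1 x *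
      (𝓕 (fun y : E => (tent y : ℂ)) (p.2 • p.1) *
        (((-(2 * Real.pi * ‖p.1‖) * Real.exp (-(2 * Real.pi * ‖p.1‖ * p.2)) : ℝ) : ℂ) *
          multiplier σ u p.1)))) (volume.prod (volume.restrict (Ioi 0))) := by
  have hT := continuous_fourier_tent (E := E)
  have hM := continuous_multiplier hσ.1.le u
  set I : ℝ := ∫ y : E, tent y with hI
  have hI0 : 0 < I := integral_tent_pos
  have hmeas : AEStronglyMeasurable (fun p : E × ℝ => ((p.2 ^ σ : ℝ) : ℂ) * (planeWave p.1 x *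
      (𝓕 (fun y : E => (tent y : ℂ)) (p.2 • p.1) *
        (((-(2 * Real.pi * ‖p.1‖) * Real.exp (-(2 * Real.pi * ‖p.1‖ * p.2)) : ℝ) : ℂ) *
          multiplier σ u p.1)))) (volume.prod (volume.restrict (Ioi 0))) := by
    have := hσ.1.le
    exact Continuous.aestronglyMeasurable (by fun_prop (disch := assumption))
  have hbound : ∀ (ξ : E) (t : ℝ), 0 < t → ‖((t ^ σ : ℝ) : ℂ) * (planeWave ξ x *
      (𝓕 (fun y : E => (tent y : ℂ)) (t • ξ) *
        (((-(2 * Real.pi * ‖ξ‖) * Real.exp (-(2 * Real.pi * ‖ξ‖ * t)) : ℝ) : ℂ) *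
          multiplier σ u ξ)))‖ ≤ I * (2 * Real.pi * ‖ξ‖) * ‖multiplier σ u ξ‖ *
            (t ^ σ * Real.exp (-(2 * Real.pi * ‖ξ‖ * t))) := by
    intro ξ t ht
    have hexp : ‖((-(2 * Real.pi * ‖ξ‖) * Real.exp (-(2 * Real.pi * ‖ξ‖ * t)) : ℝ) : ℂ)‖ =
        2 * Real.pi * ‖ξ‖ * Real.exp (-(2 * Real.pi * ‖ξ‖ * t)) := by
      rw [Complex.norm_real, neg_mul, norm_neg, Real.norm_of_nonneg (by positivity)]
    rw [norm_mul, norm_mul, norm_mul, norm_mul, hexp, norm_planeWave, one_mul, Complex.norm_real,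
      Real.norm_of_nonneg (by positivity : 0 ≤ t ^ σ)]
    calc _ ≤ t ^ σ * (I * (2 * Real.pi * ‖ξ‖ * Real.exp (-(2 * Real.pi * ‖ξ‖ * t)) *
          ‖multiplier σ u ξ‖)) := by
          gcongr
          exact norm_fourier_tent_le _
      _ = _ := by ring
  -- At `ξ = 0` the exponential gives no decay in `t`, but there the multiplier vanishes because `σ
  -- > 0`.
  have hm0 : multiplier σ u 0 = 0 := by simp [multiplier, Real.zero_rpow hσ.1.ne']
  have hdom : ∀ ξ : E, IntegrableOn (fun t : ℝ => I * (2 * Real.pi * ‖ξ‖) * ‖multiplier σ u ξ‖ *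
      (t ^ σ * Real.exp (-(2 * Real.pi * ‖ξ‖ * t)))) (Ioi 0) := by
    intro ξ
    rcases eq_or_ne ξ 0 with rfl | hξ
    · simp [hm0]
    · have := norm_pos_iff.2 hξ
      exact (integrableOn_rpow_mul_exp (by linarith [hσ.1]) (by positivity)).const_mul _
  rw [integrable_prod_iff hmeas]
  have hsec : ∀ ξ : E, AEStronglyMeasurable (fun t : ℝ => ((t ^ σ : ℝ) : ℂ) * (planeWave ξ x *
      (𝓕 (fun y : E => (tent y : ℂ)) (t • ξ) *
        (((-(2 * Real.pi * ‖ξ‖) * Real.exp (-(2 * Real.pi * ‖ξ‖ * t)) : ℝ) : ℂ) *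
          multiplier σ u ξ)))) (volume.restrict (Ioi 0)) := by
    intro ξ
    have := hσ.1.le
    exact Continuous.aestronglyMeasurable (by fun_prop (disch := assumption))
  refine ⟨ae_of_all _ fun ξ => (hdom ξ).mono' (hsec ξ)
    ((ae_restrict_iff' measurableSet_Ioi).2 (ae_of_all _ fun t ht => hbound ξ t ht)), ?_⟩
  -- With `r = 2π|ξ|`, the `t`-integral contributes `r ^ (-σ - 1)`, which cancels the factor `r` of
  -- the normal derivative and the factor `r ^ σ` of the multiplier. Only an integrable multiple of
  -- `|𝓕 u|` is left.
  refine ((integrable_fourier_schwartz u).norm.const_mul (I * Real.Gamma (σ + 1))).mono'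
    hmeas.norm.integral_prod_right' (ae_of_all _ fun ξ => ?_)
  rw [Real.norm_of_nonneg (integral_nonneg fun _ => norm_nonneg _)]
  have hG := Real.Gamma_pos_of_pos (s := σ + 1) (by linarith [hσ.1])
  rcases eq_or_ne ξ 0 with rfl | hξ
  · simp only [hm0, mul_zero, norm_zero, integral_zero]
    positivity
  · have hn := norm_pos_iff.2 hξ
    refine (integral_mono_of_nonneg (ae_of_all _ fun _ => norm_nonneg _) (hdom ξ)
      ((ae_restrict_iff' measurableSet_Ioi).2 (ae_of_all _ fun t ht => hbound ξ t ht))).trans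
        (le_of_eq ?_)
    rw [integral_const_mul, integral_rpow_mul_exp (by linarith [hσ.1]) (by positivity), multiplier,
      norm_mul, Complex.norm_real, Real.norm_of_nonneg (by positivity)]
    set r := 2 * Real.pi * ‖ξ‖
    have hr : 0 < r := by positivity
    rw [Real.rpow_add_one (by positivity), one_div, Real.inv_rpow hr.le]
    have := Real.rpow_pos_of_pos hr σ
    field_simp

/-- The superposition of dilated bumps, at height `t`. -/
noncomputable def bumpAverage (σ : ℝ) (u : 𝓢(E, ℂ)) (x : E) (t : ℝ) : ℂ :=
  ((t ^ σ : ℝ) : ℂ) * ∫ y : E, (dilatedTent t y : ℂ) * normalDeriv (multiplier σ u) (x - y) t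

lemma bumpAverage_eq {σ : ℝ} (hσ : σ ∈ Ioo (0 : ℝ) 1) (u : 𝓢(E, ℂ)) (x : E) {t : ℝ} (ht : 0 < t) :
    bumpAverage σ u x t = ∫ ξ, ((t ^ σ : ℝ) : ℂ) * (planeWave ξ x *
      (𝓕 (fun y : E => (tent y : ℂ)) (t • ξ) *
        (((-(2 * Real.pi * ‖ξ‖) * Real.exp (-(2 * Real.pi * ‖ξ‖ * t)) : ℝ) : ℂ) *
          multiplier σ u ξ))) := by
  rw [bumpAverage, integral_const_mul, integral_dilatedTent_mul_normalDeriv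
    (integrable_multiplier ⟨hσ.1, hσ.2.trans one_lt_two⟩ u) x ht]

lemma integrableOn_bumpAverage {σ : ℝ} (hσ : σ ∈ Ioo (0 : ℝ) 1) (u : 𝓢(E, ℂ)) (x : E) :
    IntegrableOn (bumpAverage σ u x) (Ioi 0) :=
  (integrable_reproducing hσ u x).integral_prod_right.congr ((ae_restrict_iff' measurableSet_Ioi).2
    (ae_of_all _ fun _ ht => (bumpAverage_eq hσ u x ht).symm))

/-- The reproducing formula for `u` in terms of the harmonic extension of `D ^ σ u`. -/
lemma exists_integral_bumpAverage_eq [Nontrivial E] {σ : ℝ} (hσ : σ ∈ Ioo (0 : ℝ) 1) :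
    ∃ c : ℂ, c ≠ 0 ∧ ∀ (u : 𝓢(E, ℂ)) (x : E), ∫ t in Ioi 0, bumpAverage σ u x t = c * u x := by
  obtain ⟨c, hc0, hc⟩ := exists_tentSymbol_eq (E := E) hσ
  -- The normal derivative has symbol `-2π|ξ| exp (-2π|ξ|t)`, whereas `tentSymbol` is defined with
  -- the opposite sign.
  refine ⟨-c, neg_ne_zero.2 hc0, fun u x => ?_⟩
  rw [setIntegral_congr_fun measurableSet_Ioi fun t ht => bumpAverage_eq hσ u x ht,
    ← integral_integral_swap (integrable_reproducing hσ u x), eq_integral_planeWave u x,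
    ← integral_const_mul]
  refine integral_congr_ae ?_
  filter_upwards [Measure.ae_ne volume (0 : E)] with ξ hξ
  have h : ∀ t : ℝ, ((t ^ σ : ℝ) : ℂ) * (planeWave ξ x *
      (𝓕 (fun y : E => (tent y : ℂ)) (t • ξ) *
        (((-(2 * Real.pi * ‖ξ‖) * Real.exp (-(2 * Real.pi * ‖ξ‖ * t)) : ℝ) : ℂ) *
          multiplier σ u ξ))) = -(planeWave ξ x * multiplier σ u ξ) *
      ((t ^ σ : ℝ) • (𝓕 (fun y : E => (tent y : ℂ)) (t • ξ) *
    ((2 * Real.pi * ‖ξ‖ * Real.exp (-(2 * Real.pi * ‖ξ‖ * t)) : ℝ) : ℂ))) := by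
    intro t
    rw [Complex.real_smul]
    push_cast
    ring
  simp_rw [h]
  rw [integral_const_mul]
  change _ * tentSymbol σ ξ = _
  rw [← hc ξ hξ, multiplier]
  ring

lemma integrable_translate_dilatedTent_mul {σ : ℝ} (hσ : σ ∈ Ioo (0 : ℝ) 1) (u : 𝓢(E, ℂ))
    (x h : E) {t : ℝ} (ht : 0 < t) :
    Integrable fun y : E => (dilatedTent t (y + h) : ℂ) *
      normalDeriv (multiplier σ u) (x - y) t := by
  have hi := integrable_multiplier ⟨hσ.1, hσ.2.trans one_lt_two⟩ u
  refine Integrable.mul_bdd (c := 1 / t * ∫ ξ, ‖multiplier σ u ξ‖)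
    (((integrable_dilatedTent (E := E) ht).comp_add_right h).ofReal) ?_
    (ae_of_all _ fun y => norm_normalDeriv_le hi _ ht)
  have := (measurable_normalDeriv (continuous_multiplier hσ.1.le u).measurable).comp
    (measurable_const.prodMk (measurable_const.sub measurable_id) :
      Measurable fun y : E => (t, x - y))
  exact this.aestronglyMeasurable

/-- Translating the integration variable moves the shift from the harmonic extension to the bump, so
differences of `u` involve only differences of `dilatedTent`. -/
lemma bumpAverage_add {σ : ℝ} (u : 𝓢(E, ℂ)) (x h : E) (t : ℝ) :
    bumpAverage σ u (x + h) t = ((t ^ σ : ℝ) : ℂ) * ∫ y : E, (dilatedTent t (y + h) : ℂ) *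
      normalDeriv (multiplier σ u) (x - y) t := by
  rw [bumpAverage, ← integral_add_right_eq_self _ h]
  simp_rw [add_sub_add_right_eq_sub]

lemma measurable_normalDeriv_sub {σ : ℝ} (hσ : σ ∈ Ioo (0 : ℝ) 1) (u : 𝓢(E, ℂ)) (x : E) :
    Measurable fun p : ℝ × E => normalDeriv (multiplier σ u) (x - p.2) p.1 := by
  have h : Measurable fun p : ℝ × E => (p.1, x - p.2) := Continuous.measurable (by fun_prop)
  have hM : Measurable (multiplier σ u) := (continuous_multiplier hσ.1.le u).measurable
  have hN := measurable_normalDeriv hM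
  generalize normalDeriv (multiplier σ u) = N at hN ⊢
  exact hN.comp h

/-- Pointwise control of differences of `u` by the harmonic extension of `D ^ σ u`. -/
lemma exists_enorm_sub_le [Nontrivial E] {σ : ℝ} (hσ : σ ∈ Ioo (0 : ℝ) 1) :
    ∃ C : ℝ≥0, ∀ (u : 𝓢(E, ℂ)) (x h : E), ‖u (x + h) - u x‖ₑ ≤ C *
      ∫⁻ p : ℝ × E, ENNReal.ofReal (p.1 ^ (σ - Module.finrank ℝ E) *
          |tent (p.1⁻¹ • (p.2 + h)) - tent (p.1⁻¹ • p.2)|) *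
        ‖normalDeriv (multiplier σ u) (x - p.2) p.1‖ₑ ∂(volume.restrict (Ioi 0)).prod volume := by
  obtain ⟨c, hc0, hc⟩ := exists_integral_bumpAverage_eq (E := E) hσ
  refine ⟨‖c⁻¹‖₊, fun u x h => ?_⟩
  have hWm := measurable_normalDeriv_sub hσ u x
  generalize hW : (fun p : ℝ × E => normalDeriv (multiplier σ u) (x - p.2) p.1) = W at hWm
  have hW' : ∀ t y, normalDeriv (multiplier σ u) (x - y) t = W (t, y) := fun t y => by rw [← hW]
  have heq : u (x + h) - u x = c⁻¹ * ∫ t in Ioi 0, ((t ^ σ : ℝ) : ℂ) * ∫ y : E,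
      ((dilatedTent t (y + h) - dilatedTent t y : ℝ) : ℂ) * W (t, y) := by
    rw [eq_inv_mul_iff_mul_eq₀ hc0, mul_sub, ← hc, ← hc,
      ← integral_sub (integrableOn_bumpAverage hσ u _) (integrableOn_bumpAverage hσ u _)]
    refine setIntegral_congr_fun measurableSet_Ioi fun t ht => ?_
    have h0 := integrable_translate_dilatedTent_mul hσ u x 0 ht
    have h1 := integrable_translate_dilatedTent_mul hσ u x h ht
    simp only [add_zero, hW'] at h0 h1
    rw [bumpAverage_add, bumpAverage]
    simp only [hW']
    rw [← mul_sub, ← integral_sub h1 h0]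
    congr 2
    funext y
    push_cast
    ring
  have hm : Measurable fun p : ℝ × E => ENNReal.ofReal (p.1 ^ (σ - Module.finrank ℝ E) *
      |tent (p.1⁻¹ • (p.2 + h)) - tent (p.1⁻¹ • p.2)|) * ‖W p‖ₑ := by
    have := (continuous_tent (E := E)).measurable
    fun_prop
  simp only [hW']
  rw [heq, enorm_mul, lintegral_prod _ hm.aemeasurable]
  refine mul_le_mul_right ((enorm_integral_le_lintegral_enorm _).trans
    (setLIntegral_mono' measurableSet_Ioi fun t (ht : 0 < t) => ?_)) _
  rw [enorm_mul]
  refine (mul_le_mul_right (enorm_integral_le_lintegral_enorm _) _).trans (le_of_eq ?_)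
  rw [← lintegral_const_mul' _ _ enorm_ne_top]
  refine lintegral_congr fun y => ?_
  rw [enorm_mul, ← mul_assoc, ← enorm_mul, ← Complex.ofReal_mul, ← ofReal_norm,
    Complex.norm_real, dilatedTent, dilatedTent, ← mul_sub, ← mul_assoc, ← Real.rpow_add ht,
    norm_mul, Real.norm_of_nonneg (by positivity), Real.norm_eq_abs, sub_eq_add_neg σ]

end Reproducing

/-! ### Second differences, the commutator and Cauchy–Schwarz. -/

section SecondDifference

/-- Cauchy–Schwarz after writing `-d - s` as the mean of `-d - 2s₁` and `-d - 2s₂`. The origin needs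
separate care, and there the left integrand vanishes because its exponent is nonzero. -/
lemma lintegral_rpow_mul_mul_le {E : Type*} [NormedAddCommGroup E] [MeasurableSpace E]
    [BorelSpace E] (μ : Measure E) {s s₁ s₂ d : ℝ} (hs : s = s₁ + s₂)
    {f g : E → ℝ≥0∞} (hf : Measurable f) (hg : Measurable g) (hs0 : -d - s ≠ 0) :
    ∫⁻ h, ENNReal.ofReal (‖h‖ ^ (-d - s)) * (f h * g h) ∂μ ≤
      (∫⁻ h, ENNReal.ofReal (‖h‖ ^ (-d - 2 * s₁)) * f h ^ 2 ∂μ) ^ (1 / 2 : ℝ) *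
      (∫⁻ h, ENNReal.ofReal (‖h‖ ^ (-d - 2 * s₂)) * g h ^ 2 ∂μ) ^ (1 / 2 : ℝ) := by
  have key := ENNReal.lintegral_mul_le_Lp_mul_Lq μ Real.HolderConjugate.two_two
    (f := fun h => ENNReal.ofReal (‖h‖ ^ ((-d - 2 * s₁) / 2)) * f h)
    (g := fun h => ENNReal.ofReal (‖h‖ ^ ((-d - 2 * s₂) / 2)) * g h)
    (Measurable.aemeasurable (by fun_prop)) (Measurable.aemeasurable (by fun_prop))
  have hsq : ∀ (a : ℝ) (h : E) (z : ℝ≥0∞), (ENNReal.ofReal (‖h‖ ^ (a / 2)) * z) ^ (2 : ℝ) =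
      ENNReal.ofReal (‖h‖ ^ a) * z ^ 2 := by
    intro a h z
    rw [ENNReal.mul_rpow_of_nonneg _ _ two_pos.le, ENNReal.rpow_two, ENNReal.rpow_two,
      ← ENNReal.ofReal_pow (by positivity), ← Real.rpow_natCast, ← Real.rpow_mul (norm_nonneg h)]
    congr 3
    push_cast
    ring
  simp only [hsq] at key
  refine le_trans (lintegral_mono fun h => ?_) key
  simp only [Pi.mul_apply]
  rcases eq_or_ne h 0 with rfl | hh
  · simp [Real.zero_rpow hs0]
  · rw [mul_mul_mul_comm, ofReal_rpow_mul_ofReal_rpow (norm_pos_iff.2 hh), hs]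
    apply le_of_eq
    congr 3
    ring

variable {E : Type*} [NormedAddCommGroup E] [InnerProductSpace ℝ E]

lemma planeWave_add_planeWave_neg (ξ h : E) :
    planeWave ξ h + planeWave ξ (-h) = ((2 * Real.cos (2 * Real.pi * inner ℝ h ξ) : ℝ) : ℂ) := by
  rw [planeWave, planeWave, inner_neg_right, mul_neg, real_inner_comm]
  push_cast
  rw [Complex.cos, neg_mul]
  ring_nf

/-- The product of two Schwartz functions. -/
lemma exists_schwartz_mul (u v : 𝓢(E, ℂ)) : ∃ w : 𝓢(E, ℂ), ∀ x, w x = u x * v x :=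
  ⟨SchwartzMap.bilinLeftCLM (ContinuousLinearMap.mul ℂ ℂ) v.hasTemperateGrowth u, fun _ => rfl⟩

variable [FiniteDimensional ℝ E] [MeasurableSpace E] [BorelSpace E]

lemma second_difference_eq (f : 𝓢(E, ℂ)) (x h : E) :
    2 * f x - f (x + h) - f (x - h) = ∫ ξ, ((2 - 2 * Real.cos (2 * Real.pi * inner ℝ h ξ) : ℝ) : ℂ) *
      (planeWave ξ x * 𝓕 (f : E → ℂ) ξ) := by
  have hi := fun y => integrable_planeWave_mul (integrable_fourier_schwartz f) y
  have hi2 : Integrable fun ξ => 2 * (planeWave ξ x * 𝓕 (f : E → ℂ) ξ) -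
    planeWave ξ (x + h) * 𝓕 (f : E → ℂ) ξ := ((hi x).const_mul 2).sub (hi (x + h))
  rw [eq_integral_planeWave f x, eq_integral_planeWave f (x + h), eq_integral_planeWave f (x - h),
    ← integral_const_mul, ← integral_sub ((hi _).const_mul _) (hi _),
    ← integral_sub hi2 (hi _)]
  congr 1
  funext ξ
  have hp := planeWave_add_planeWave_neg ξ h
  rw [sub_eq_add_neg x h, planeWave_add, planeWave_add, Complex.ofReal_sub, ← hp]
  push_cast
  ring

/-- The kernel is nonnegative, so integrating absolute values in `h` reproduces `differenceSymbol`
exactly and leaves `c |multiplier s f|`, which is integrable. -/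
lemma integrable_second_difference_symbol [Nontrivial E] {s : ℝ} (hs : s ∈ Ioo (0 : ℝ) 2)
    (f : 𝓢(E, ℂ)) (x : E) :
    Integrable (fun p : E × E =>
      ((‖p.2‖ ^ (-Module.finrank ℝ E - s : ℝ) *
        (2 - 2 * Real.cos (2 * Real.pi * inner ℝ p.2 p.1)) : ℝ) : ℂ) *
      (planeWave p.1 x * 𝓕 (f : E → ℂ) p.1)) (volume.prod volume) := by
  have hF := (continuous_fourier_schwartz f).measurable
  have hmeas : AEStronglyMeasurable (fun p : E × E =>
      ((‖p.2‖ ^ (-Module.finrank ℝ E - s : ℝ) *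
        (2 - 2 * Real.cos (2 * Real.pi * inner ℝ p.2 p.1)) : ℝ) : ℂ) *
      (planeWave p.1 x * 𝓕 (f : E → ℂ) p.1)) (volume.prod volume) := by
    have hP : Measurable fun p : E × E => planeWave p.1 x := Continuous.measurable (by fun_prop)
    have hC : Measurable fun p : E × E => Real.cos (2 * Real.pi * inner ℝ p.2 p.1) :=
      Continuous.measurable (by fun_prop)
    exact Measurable.aestronglyMeasurable (by fun_prop)
  obtain ⟨c, hc0, hc⟩ := exists_differenceSymbol_eq (E := E) hs
  rw [integrable_prod_iff hmeas]
  refine ⟨ae_of_all _ fun ξ => (integrable_differenceSymbol hs ξ).ofReal.mul_const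
    (planeWave ξ x * 𝓕 (f : E → ℂ) ξ), ?_⟩
  refine ((integrable_multiplier hs f).norm.const_mul c).congr (ae_of_all _ fun ξ => ?_)
  have hn : ∀ h : E, ‖((‖h‖ ^ (-Module.finrank ℝ E - s : ℝ) *
        (2 - 2 * Real.cos (2 * Real.pi * inner ℝ h ξ)) : ℝ) : ℂ) *
      (planeWave ξ x * 𝓕 (f : E → ℂ) ξ)‖ = ‖h‖ ^ (-Module.finrank ℝ E - s : ℝ) *
        (2 - 2 * Real.cos (2 * Real.pi * inner ℝ h ξ)) * ‖𝓕 (f : E → ℂ) ξ‖ := by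
    intro h
    rw [norm_mul, norm_mul, norm_planeWave, one_mul, Complex.norm_real,
      Real.norm_of_nonneg (differenceSymbol_integrand_nonneg s ξ h)]
  simp only [hn]
  rw [integral_mul_const]
  change _ = differenceSymbol s ξ * _
  rw [hc, multiplier, norm_mul, Complex.norm_real, Real.norm_of_nonneg (by positivity),
    ← mul_assoc]

lemma integrable_second_difference [Nontrivial E] {s : ℝ} (hs : s ∈ Ioo (0 : ℝ) 2)
    (f : 𝓢(E, ℂ)) (x : E) :
    Integrable fun h : E => ((‖h‖ ^ (-Module.finrank ℝ E - s : ℝ) : ℝ) : ℂ) *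
      (2 * f x - f (x + h) - f (x - h)) := by
  refine (integrable_second_difference_symbol hs f x).integral_prod_right.congr
    (ae_of_all _ fun h => ?_)
  simp only
  rw [second_difference_eq, ← integral_const_mul]
  congr 1
  funext ξ
  push_cast
  ring

/-- `D ^ s` as an integral of second differences. -/
lemma exists_integral_second_difference_eq [Nontrivial E] {s : ℝ} (hs : s ∈ Ioo (0 : ℝ) 2) :
    ∃ c : ℂ, c ≠ 0 ∧ ∀ (f : 𝓢(E, ℂ)) (x : E),
      ∫ h : E, ((‖h‖ ^ (-Module.finrank ℝ E - s : ℝ) : ℝ) : ℂ) *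
        (2 * f x - f (x + h) - f (x - h)) = c * 𝓕⁻ (multiplier s f) x := by
  obtain ⟨c, hc0, hc⟩ := exists_differenceSymbol_eq (E := E) hs
  refine ⟨c, by exact_mod_cast hc0.ne', fun f x => ?_⟩
  calc _ = ∫ h : E, ∫ ξ : E, ((‖h‖ ^ (-Module.finrank ℝ E - s : ℝ) *
        (2 - 2 * Real.cos (2 * Real.pi * inner ℝ h ξ)) : ℝ) : ℂ) *
      (planeWave ξ x * 𝓕 (f : E → ℂ) ξ) := by
        congr 1
        funext h
        rw [second_difference_eq, ← integral_const_mul]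
        congr 1
        funext ξ
        push_cast
        ring
    _ = ∫ ξ : E, ∫ h : E, ((‖h‖ ^ (-Module.finrank ℝ E - s : ℝ) *
        (2 - 2 * Real.cos (2 * Real.pi * inner ℝ h ξ)) : ℝ) : ℂ) *
      (planeWave ξ x * 𝓕 (f : E → ℂ) ξ) :=
        (integral_integral_swap (integrable_second_difference_symbol hs f x)).symm
    _ = _ := by
        rw [fourierInv_eq_integral_planeWave, ← integral_const_mul]
        congr 1
        funext ξ
        rw [integral_mul_const, integral_complex_ofReal]
        change ((differenceSymbol s ξ : ℝ) : ℂ) * _ = _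
        rw [hc, multiplier]
        push_cast
        ring

/-- The commutator of `D ^ s` is bounded by an integral of products of first differences. -/
lemma exists_enorm_commutator_le [Nontrivial E] {s : ℝ} (hs : s ∈ Ioo (0 : ℝ) 2) :
    ∃ C : ℝ≥0, ∀ (u v w : 𝓢(E, ℂ)), (∀ x, w x = u x * v x) → ∀ x,
      ‖𝓕⁻ (multiplier s w) x - u x * 𝓕⁻ (multiplier s v) x - v x * 𝓕⁻ (multiplier s u) x‖ₑ ≤
      C * ∫⁻ h : E, ENNReal.ofReal (‖h‖ ^ (-Module.finrank ℝ E - s : ℝ)) *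
        (‖u (x + h) - u x‖ₑ * ‖v (x + h) - v x‖ₑ) := by
  obtain ⟨c, hc0, hc⟩ := exists_integral_second_difference_eq (E := E) hs
  refine ⟨‖c⁻¹‖₊ * 2, fun u v w hw x => ?_⟩
  set k : E → ℝ := fun h => ‖h‖ ^ (-Module.finrank ℝ E - s : ℝ) with hk
  have hi := fun f : 𝓢(E, ℂ) => integrable_second_difference hs f x
  have hi2 : Integrable fun h : E => ((k h : ℝ) : ℂ) * (2 * w x - w (x + h) - w (x - h)) -
      u x * (((k h : ℝ) : ℂ) * (2 * v x - v (x + h) - v (x - h))) :=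
    (hi w).sub ((hi v).const_mul (u x))
  -- For each of `h` and `-h`, the contributions of `w = u v`, `u v` and `v u` to the second
  -- differences sum to minus a product of first differences.
  have heq : 𝓕⁻ (multiplier s w) x - u x * 𝓕⁻ (multiplier s v) x - v x * 𝓕⁻ (multiplier s u) x =
      c⁻¹ * ∫ h, ((k h : ℝ) : ℂ) * (-((u (x + h) - u x) * (v (x + h) - v x)) -
        (u (x + -h) - u x) * (v (x + -h) - v x)) := by
    rw [eq_inv_mul_iff_mul_eq₀ hc0, mul_sub, mul_sub, mul_left_comm, mul_left_comm c (v x),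
      ← hc, ← hc, ← hc, ← integral_const_mul, ← integral_const_mul,
      ← integral_sub (hi w) ((hi v).const_mul _),
      ← integral_sub hi2 ((hi u).const_mul _)]
    congr 1
    funext h
    simp only [hw, hk, sub_eq_add_neg]
    ring
  have hk0 : ∀ h, 0 ≤ k h := fun h => by positivity
  have hkm : Measurable k := by fun_prop
  have hu := u.continuous.measurable
  have hv := v.continuous.measurable
  -- Evenness of `k` makes the two products contribute equally, which is the factor `2` in the
  -- constant.
  have hneg : ∫⁻ h, ENNReal.ofReal (k h) * (‖u (x + -h) - u x‖ₑ * ‖v (x + -h) - v x‖ₑ) =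
      ∫⁻ h, ENNReal.ofReal (k h) * (‖u (x + h) - u x‖ₑ * ‖v (x + h) - v x‖ₑ) := by
    rw [← lintegral_neg_eq_self fun h : E =>
      ENNReal.ofReal (k h) * (‖u (x + h) - u x‖ₑ * ‖v (x + h) - v x‖ₑ)]
    simp [hk]
  rw [heq, enorm_mul]
  push_cast
  rw [mul_assoc]
  refine mul_le_mul_right ((enorm_integral_le_lintegral_enorm _).trans ?_) _
  calc _ ≤ ∫⁻ h, (ENNReal.ofReal (k h) * (‖u (x + h) - u x‖ₑ * ‖v (x + h) - v x‖ₑ) +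
        ENNReal.ofReal (k h) * (‖u (x + -h) - u x‖ₑ * ‖v (x + -h) - v x‖ₑ)) := by
        refine lintegral_mono fun h => ?_
        rw [enorm_mul, ← mul_add, ← ofReal_norm, Complex.norm_real,
          Real.norm_of_nonneg (hk0 h)]
        gcongr
        refine (enorm_sub_le).trans ?_
        rw [enorm_neg, enorm_mul, enorm_mul]
    _ = _ := by
        rw [lintegral_add_left (by fun_prop), hneg, two_mul]

end SecondDifference

/-! ### First differences bounded by `g*`. -/

section SquareFunction

variable {n : ℕ}

local notation "𝔼" => EuclideanSpace ℝ (Fin n)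

lemma fracD_eq_fourierInv_multiplier (s : ℝ) (u : 𝓢(𝔼, ℂ)) :
    fracD s u = 𝓕⁻ (multiplier s u) := rfl

/-- Since `t / (t + |y|) ≤ 1`, raising the exponent from `lam * n` to `κ` only decreases the weight.
-/
lemma lintegral_coneWeight_mul_le {σ lam κ : ℝ} (hσ : σ ∈ Ioo (0 : ℝ) 1) (hκ : lam * n ≤ κ)
    (u : 𝓢(𝔼, ℂ)) (x : 𝔼) :
    ∫⁻ p : ℝ × 𝔼, coneWeight n κ p * ‖normalDeriv (multiplier σ u) (x - p.2) p.1‖ₑ ^ 2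
      ∂(volume.restrict (Ioi 0)).prod volume ≤ gStar lam (fracD σ u) x ^ 2 := by
  rw [gStar, ← ENNReal.rpow_two, ← ENNReal.rpow_mul, one_div_mul_cancel two_ne_zero,
    ENNReal.rpow_one]
  have hi := integrable_multiplier ⟨hσ.1, hσ.2.trans one_lt_two⟩ u
  have hm : Measurable fun p : ℝ × 𝔼 => coneWeight n κ p := by
    unfold coneWeight
    fun_prop
  have hN := measurable_normalDeriv_sub hσ u x
  have hmN : Measurable fun p : ℝ × 𝔼 =>
      coneWeight n κ p * ‖normalDeriv (multiplier σ u) (x - p.2) p.1‖ₑ ^ 2 :=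
    hm.mul (hN.enorm.pow_const 2)
  rw [lintegral_prod _ hmN.aemeasurable]
  refine setLIntegral_mono' measurableSet_Ioi fun t (ht : 0 < t) => lintegral_mono fun y => ?_
  simp only [coneWeight]
  rw [← ofReal_norm, ← ENNReal.ofReal_pow (norm_nonneg _),
    ← ENNReal.ofReal_mul (by positivity), mul_comm (t ^ (1 - (n : ℝ)))]
  refine ENNReal.ofReal_le_ofReal ?_
  have hbase : t / (t + ‖y‖) ≤ 1 := div_le_one_of_le₀ (by linarith [norm_nonneg y]) (by positivity)
  have hw := Real.rpow_le_rpow_of_exponent_ge (by positivity : 0 < t / (t + ‖y‖)) hbase hκ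
  have hg := sq_norm_normalDeriv_le_gradSq hi (x - y) ht
  rw [fracD_eq_fourierInv_multiplier]
  gcongr

/-- The square integral of the differences of `u` is bounded by `g*` of `D ^ σ u`. -/
lemma exists_difference_le_gStar [Nontrivial 𝔼] {σ lam : ℝ} (hσ : σ ∈ Ioo (0 : ℝ) 1)
    (hlam : lam * n < n + 2 * σ) :
    ∃ C : ℝ≥0, ∀ (u : 𝓢(𝔼, ℂ)) (x : 𝔼),
      (∫⁻ h : 𝔼, ENNReal.ofReal (‖h‖ ^ (-n - 2 * σ : ℝ)) * ‖u (x + h) - u x‖ₑ ^ 2) ^ (1 / 2 : ℝ) ≤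
        C * gStar lam (fracD σ u) x := by
  -- The loss `ε` must stay below `2σ` for the Schur estimates and within the gap `n + 2σ - lam * n`
  -- left by the strict hypothesis.
  obtain ⟨ε, hε0, hεσ, hε⟩ : ∃ ε : ℝ, 0 < ε ∧ ε < 2 * σ ∧ lam * n ≤ n + 2 * σ - ε :=
    ⟨min σ (n + 2 * σ - lam * n), lt_min hσ.1 (by linarith),
      (min_le_left _ _).trans_lt (by linarith [hσ.1]),
      by linarith [min_le_right σ (n + 2 * σ - lam * n)]⟩
  obtain ⟨C₁, h₁⟩ := exists_enorm_sub_le (E := 𝔼) hσ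
  obtain ⟨C₂, h₂⟩ := exists_lintegral_sq_tent_sub_le (volume : Measure 𝔼) hσ hε0 hεσ
  simp only [finrank_euclideanSpace_fin] at h₁ h₂
  refine ⟨(C₁ ^ 2 * C₂) ^ (1 / 2 : ℝ), fun u x => ?_⟩
  have h₃ := h₂ _ (measurable_normalDeriv_sub hσ u x).enorm
  rw [ENNReal.coe_rpow_of_nonneg _ (by norm_num : (0 : ℝ) ≤ 1 / 2)]
  have hroot : gStar lam (fracD σ u) x = (gStar lam (fracD σ u) x ^ 2) ^ (1 / 2 : ℝ) := by
    rw [← ENNReal.rpow_two, ← ENNReal.rpow_mul, mul_one_div_cancel two_ne_zero, ENNReal.rpow_one]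
  rw [hroot, ← ENNReal.mul_rpow_of_nonneg _ _ (by norm_num)]
  refine ENNReal.rpow_le_rpow ?_ (by norm_num)
  push_cast
  calc _ ≤ ∫⁻ h : 𝔼, (C₁ : ℝ≥0∞) ^ 2 * (ENNReal.ofReal (‖h‖ ^ (-n - 2 * σ : ℝ)) *
        (∫⁻ p : ℝ × 𝔼, ENNReal.ofReal (p.1 ^ (σ - n) *
          |tent (p.1⁻¹ • (p.2 + h)) - tent (p.1⁻¹ • p.2)|) *
        ‖normalDeriv (multiplier σ u) (x - p.2) p.1‖ₑ
          ∂(volume.restrict (Ioi 0)).prod volume) ^ 2) := by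
        refine lintegral_mono fun h => ?_
        rw [mul_left_comm, ← mul_pow]
        exact mul_le_mul_right (pow_le_pow_left' (h₁ u x h) 2) _
    _ ≤ C₁ ^ 2 * (C₂ * gStar lam (fracD σ u) x ^ 2) := by
        rw [lintegral_const_mul' _ _ (by finiteness)]
        exact mul_le_mul_right (h₃.trans (mul_le_mul_right
          (lintegral_coneWeight_mul_le hσ hε u x) _)) _
    _ = _ := by ring

end SquareFunction

end FracCommutator

/-! ### Assembly of the bilinear estimate. -/

theorem proposition2p3 (n : ℕ) (hn : 1 ≤ n) (s s₁ s₂ lam₁ lam₂ : ℝ)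
    (hs : s = s₁ + s₂) (hs02 : s ∈ Set.Ioo (0 : ℝ) 2)
    (hs₁ : s₁ ∈ Set.Ioo (0 : ℝ) 1) (hs₂ : s₂ ∈ Set.Ioo (0 : ℝ) 1)
    (hlam₁ : lam₁ < 1 + 2 * s₁ / n) (hlam₂ : lam₂ < 1 + 2 * s₂ / n) :
    ∃ C : ℝ≥0, ∀ (u v : 𝓢(EuclideanSpace ℝ (Fin n), ℂ)) (x : EuclideanSpace ℝ (Fin n)),
      ‖FracCommutator.fracD s (fun z => u z * v z) x - u x * FracCommutator.fracD s v x
          - v x * FracCommutator.fracD s u x‖ₑ ≤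
        (C : ℝ≥0∞) * (FracCommutator.gStar lam₁ (FracCommutator.fracD s₁ u) x *
          FracCommutator.gStar lam₂ (FracCommutator.fracD s₂ v) x) := by
  have hn0 : (0 : ℝ) < n := by exact_mod_cast hn
  have : Nontrivial (EuclideanSpace ℝ (Fin n)) :=
    Module.nontrivial_of_finrank_pos (R := ℝ) (by rw [finrank_euclideanSpace_fin]; omega)
  have hl : ∀ {lam σ : ℝ}, lam < 1 + 2 * σ / n → lam * n < n + 2 * σ := by
    intro lam σ h
    have := mul_lt_mul_of_pos_right h hn0
    rwa [add_mul, one_mul, div_mul_cancel₀ _ hn0.ne'] at this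
  obtain ⟨C₀, h₀⟩ := FracCommutator.exists_enorm_commutator_le
    (E := EuclideanSpace ℝ (Fin n)) hs02
  obtain ⟨C₁, h₁⟩ := FracCommutator.exists_difference_le_gStar hs₁ (hl hlam₁)
  obtain ⟨C₂, h₂⟩ := FracCommutator.exists_difference_le_gStar hs₂ (hl hlam₂)
  refine ⟨C₀ * (C₁ * C₂), fun u v x => ?_⟩
  -- The product is itself a Schwartz function, so the second difference formula applies to it as
  -- well.
  obtain ⟨w, hw⟩ := FracCommutator.exists_schwartz_mul u v
  have hwf : (fun z => u z * v z) = w := funext fun z => (hw z).symm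
  rw [hwf]
  simp only [finrank_euclideanSpace_fin] at h₀
  refine (h₀ u v w hw x).trans ?_
  have hmu : Measurable fun h => ‖u (x + h) - u x‖ₑ :=
    (Continuous.measurable (by fun_prop : Continuous fun h => u (x + h) - u x)).enorm
  have hmv : Measurable fun h => ‖v (x + h) - v x‖ₑ :=
    (Continuous.measurable (by fun_prop : Continuous fun h => v (x + h) - v x)).enorm
  have hCS := FracCommutator.lintegral_rpow_mul_mul_le volume (d := n) hs hmu hmv
    (by linarith [hs02.1])
  push_cast
  rw [mul_assoc (C₀ : ℝ≥0∞), mul_mul_mul_comm]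
  exact mul_le_mul_right (hCS.trans (mul_le_mul' (h₁ u x) (h₂ v x))) _
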